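/- Let $\mathcal{E}$ be a category with finite limits. A morphism $f\colon B\to A$ of $\mathcal{E}$ is *exponentiable* if the pullback functor $\Delta_f\colon\mathcal{E}/A\to\mathcal{E}/B$ has a right adjoint $\Pi_f$. Let $\mathbf{Poly}_{\mathcal{E}}$ be the category whose objects (polynomials) are the exponentiable morphisms $p\colon P_*\to P$ of $\mathcal{E}$, and whose morphisms $\phi\colon p\to q$ consist of a morphism $\phi_1\colon P\to Q$ and a morphism $\phi^\sharp\colon P\times_Q Q_*\to P_*$ over $P$; the composite of $\phi\colon p\to q$ and $\psi\colon q\to r$ is $\psi_1\circ\phi_1$ on positions and $P\times_R R_*\cong P\times_Q(Q\times_R R_*)\to P\times_Q Q_*\to P_*$ on directions. Let $y$ be the polynomial $\mathrm{id}_1\colon 1\to 1$. For polynomials $p,q$ let $p\otimes q$ be the polynomial $p\times q\colon P_*\times Q_*\to P\times Q$, and let $p\mathbin{\triangleleft}q$ be the composite $$(\Pi_p(Q\times P_*)\times_P P_*)\times_Q Q_*\;\to\;\Pi_p(Q\times P_*)\times_P P_*\;\to\;\Pi_p(Q\times P_*),$$ where $Q\times P_*$ is regarded as an object over $P_*$ by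 projection and the map $\Pi_p(Q\times P_*)\times_P P_*\to Q$ used to form the outer pullback is the counit of $\Delta_p\dashv\Pi_p$ followed by projection. Both operations act on morphisms in the evident way (for $\otimes$: by $\phi_1\times\psi_1$ and $\phi^\sharp\times\psi^\sharp$). **Theorem.** The tensor product extends to a functor $\otimes\colon\mathbf{Poly}_{\mathcal{E}}\times\mathbf{Poly}_{\mathcal{E}}\to\mathbf{Poly}_{\mathcal{E}}$ such that, with the associator and unitors induced by those of the cartesian product of $\mathcal{E}$, $(\mathbf{Poly}_{\mathcal{E}},y,\otimes)$ is a monoidal category. Furthermore, $(\mathbf{Poly}_{\mathcal{E}},y,\otimes,y,\triangleleft)$ is a normal duoidal category: $(\mathbf{Poly}_{\mathcal{E}},y,\triangleleft)$, with its canonical associator and unitors, is also a monoidal category, and the canonical natural interchange morphisms $$(p\mathbin{\triangleleft}q)\otimes(r\mathbin{\triangleleft}s)\;\to\;(p\otimes r)\mathbin{\triangleleft}(q\otimes s),$$ (sending positions $((I,J),(K,L))$ to $(I,K,J\times L)$ and invertible on directions), together with the canonical morphisms $y\to y\mathbin{\triangleleft}y$, $y\otimes y\to y$ and $\mathrm{id}\colon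 y\to y$, satisfy the associativity, unitality and unit axioms of a duoidal category, the comparison $y\to y$ between the two units being an isomorphism. -/

import Mathlib

open CategoryTheory CategoryTheory.Limits

universe v u


/-- The data of a duoidal category: two monoidal structures `(⊗, I) = M` and `(◁, J) = N` on the same
category, the interchange morphisms `(A ◁ B) ⊗ (D ◁ F) ⟶ (A ⊗ D) ◁ (B ⊗ F)`, and the morphisms
`I ⟶ I ◁ I`, `J ⊗ J ⟶ J` and `I ⟶ J`. -/
structure DuoidalStruct (C : Type u) [Category.{v} C] where
  /-- the data of the first monoidal structure `(⊗, I)` -/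
  M : MonoidalCategoryStruct C
  /-- the data of the second monoidal structure `(◁, J)` -/
  N : MonoidalCategoryStruct C
  /-- the interchange -/
  interchange (A B D F : C) : M.tensorObj (N.tensorObj A B) (N.tensorObj D F) ⟶
    N.tensorObj (M.tensorObj A D) (M.tensorObj B F)
  /-- the morphism `I ⟶ I ◁ I` -/
  comult : M.tensorUnit ⟶ N.tensorObj M.tensorUnit M.tensorUnit
  /-- the morphism `J ⊗ J ⟶ J` -/
  mult : M.tensorObj N.tensorUnit N.tensorUnit ⟶ N.tensorUnit
  /-- the morphism `I ⟶ J` -/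
  unit : M.tensorUnit ⟶ N.tensorUnit

/-- The given data satisfy the axioms of a monoidal category. -/
def IsMonoidal {C : Type u} [Category.{v} C] (S : MonoidalCategoryStruct C) : Prop :=
  ∃ M : MonoidalCategory C, M.toMonoidalCategoryStruct = S

/-- The axioms of a duoidal category (also called a 2-monoidal category): both structures are
monoidal, the interchange is natural, and the structure morphisms satisfy the associativity,
unitality and unit axioms. Equivalently, `⊗` and `I` are colax monoidal functors for `(◁, J)`, and
the associator and unitors of `⊗` are monoidal transformations. -/
structure DuoidalStruct.IsDuoidal {C : Type u} [Category.{v} C] (S : DuoidalStruct C) : Prop where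
  monoidal_M : IsMonoidal S.M
  monoidal_N : IsMonoidal S.N
  interchange_natural {A A' B B' D D' F F' : C} (a : A ⟶ A') (b : B ⟶ B') (d : D ⟶ D')
    (f : F ⟶ F') :
    S.M.tensorHom (S.N.tensorHom a b) (S.N.tensorHom d f) ≫ S.interchange A' B' D' F' =
      S.interchange A B D F ≫ S.N.tensorHom (S.M.tensorHom a d) (S.M.tensorHom b f)
  /-- associativity with respect to `⊗` -/
  interchange_assoc_M (A B D F G H : C) :
    S.M.whiskerRight (S.interchange A B D F) (S.N.tensorObj G H) ≫
        S.interchange (S.M.tensorObj A D) (S.M.tensorObj B F) G H ≫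
        S.N.tensorHom (S.M.associator A D G).hom (S.M.associator B F H).hom =
      (S.M.associator (S.N.tensorObj A B) (S.N.tensorObj D F) (S.N.tensorObj G H)).hom ≫
        S.M.whiskerLeft (S.N.tensorObj A B) (S.interchange D F G H) ≫
        S.interchange A B (S.M.tensorObj D G) (S.M.tensorObj F H)
  /-- associativity with respect to `◁` -/
  interchange_assoc_N (A B D F G H : C) :
    S.interchange (S.N.tensorObj A B) D (S.N.tensorObj F G) H ≫
        S.N.whiskerRight (S.interchange A B F G) (S.M.tensorObj D H) ≫
        (S.N.associator (S.M.tensorObj A F) (S.M.tensorObj B G) (S.M.tensorObj D H)).hom =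
      S.M.tensorHom (S.N.associator A B D).hom (S.N.associator F G H).hom ≫
        S.interchange A (S.N.tensorObj B D) F (S.N.tensorObj G H) ≫
        S.N.whiskerLeft (S.M.tensorObj A F) (S.interchange B D G H)
  /-- left unitality with respect to `⊗` -/
  left_unit_M (A B : C) :
    S.M.whiskerRight S.comult (S.N.tensorObj A B) ≫
        S.interchange S.M.tensorUnit S.M.tensorUnit A B ≫
        S.N.tensorHom (S.M.leftUnitor A).hom (S.M.leftUnitor B).hom =
      (S.M.leftUnitor (S.N.tensorObj A B)).hom
  /-- right unitality with respect to `⊗` -/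
  right_unit_M (A B : C) :
    S.M.whiskerLeft (S.N.tensorObj A B) S.comult ≫
        S.interchange A B S.M.tensorUnit S.M.tensorUnit ≫
        S.N.tensorHom (S.M.rightUnitor A).hom (S.M.rightUnitor B).hom =
      (S.M.rightUnitor (S.N.tensorObj A B)).hom
  /-- left unitality with respect to `◁` -/
  left_unit_N (A B : C) :
    S.interchange S.N.tensorUnit A S.N.tensorUnit B ≫
        S.N.whiskerRight S.mult (S.M.tensorObj A B) ≫ (S.N.leftUnitor (S.M.tensorObj A B)).hom =
      S.M.tensorHom (S.N.leftUnitor A).hom (S.N.leftUnitor B).hom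
  /-- right unitality with respect to `◁` -/
  right_unit_N (A B : C) :
    S.interchange A S.N.tensorUnit B S.N.tensorUnit ≫
        S.N.whiskerLeft (S.M.tensorObj A B) S.mult ≫ (S.N.rightUnitor (S.M.tensorObj A B)).hom =
      S.M.tensorHom (S.N.rightUnitor A).hom (S.N.rightUnitor B).hom
  /-- `J` is a monoid for `⊗` -/
  unit_mult : S.M.whiskerRight S.unit S.N.tensorUnit ≫ S.mult = (S.M.leftUnitor S.N.tensorUnit).hom
  mult_unit : S.M.whiskerLeft S.N.tensorUnit S.unit ≫ S.mult = (S.M.rightUnitor S.N.tensorUnit).hom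
  mult_assoc : S.M.whiskerRight S.mult S.N.tensorUnit ≫ S.mult =
    (S.M.associator S.N.tensorUnit S.N.tensorUnit S.N.tensorUnit).hom ≫
      S.M.whiskerLeft S.N.tensorUnit S.mult ≫ S.mult
  /-- `I` is a comonoid for `◁` -/
  unit_comult : S.comult ≫ S.N.whiskerRight S.unit S.M.tensorUnit ≫
    (S.N.leftUnitor S.M.tensorUnit).hom = 𝟙 S.M.tensorUnit
  comult_unit : S.comult ≫ S.N.whiskerLeft S.M.tensorUnit S.unit ≫
    (S.N.rightUnitor S.M.tensorUnit).hom = 𝟙 S.M.tensorUnit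
  comult_assoc : S.comult ≫ S.N.whiskerRight S.comult S.M.tensorUnit ≫
      (S.N.associator S.M.tensorUnit S.M.tensorUnit S.M.tensorUnit).hom =
    S.comult ≫ S.N.whiskerLeft S.M.tensorUnit S.comult

/-- A duoidal category is normal if the morphism `I ⟶ J` between the units is invertible. -/
structure DuoidalStruct.IsNormalDuoidal {C : Type u} [Category.{v} C] (S : DuoidalStruct C) :
    Prop where
  isDuoidal : S.IsDuoidal
  isIso_unit : IsIso S.unit

/-- A morphism `f : B ⟶ A` is exponentiable if the pullback functor `Over A ⥤ Over B` has a right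
adjoint. -/
def Exponentiable {E : Type u} [Category.{v} E] [HasPullbacks E] {B A : E} (f : B ⟶ A) : Prop :=
  (Over.pullback f).IsLeftAdjoint

namespace Exponentiable

variable {E : Type u} [Category.{v} E] [HasPullbacks E]

theorem of_isIso {B A : E} (f : B ⟶ A) [IsIso f] : Exponentiable f := by
  have : (Over.pullback f).IsEquivalence :=
    (Over.mapPullbackAdj f).isEquivalence_right_of_isEquivalence_left
  unfold Exponentiable
  infer_instance

theorem comp {C B A : E} {g : C ⟶ B} {f : B ⟶ A} (hg : Exponentiable g) (hf : Exponentiable f) :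
    Exponentiable (g ≫ f) := by
  unfold Exponentiable at *
  exact Functor.isLeftAdjoint_of_iso (Over.pullbackComp g f).symm

theorem pullback_fst {B A C : E} {f : B ⟶ A} (hf : Exponentiable f) (g : C ⟶ A) :
    Exponentiable (pullback.fst g f) := by
  unfold Exponentiable at *
  let F : Over C ⥤ Over (pullback g f) :=
    (Over.iteratedSliceEquiv (Over.mk g)).inverse ⋙ Over.post (Over.pullback f) ⋙
      (Over.iteratedSliceEquiv ((Over.pullback f).obj (Over.mk g))).functor
  have : F.IsLeftAdjoint := inferInstance
  let e (X : Over C) : pullback (X.hom ≫ g) f ≅ pullback X.hom (pullback.fst g f) :=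
    { hom := pullback.lift (pullback.fst _ _)
        (pullback.lift (pullback.fst _ _ ≫ X.hom) (pullback.snd _ _)
          (by simpa using pullback.condition)) (by simp [pullback.lift_fst])
      inv := pullback.lift (pullback.fst _ _) (pullback.snd _ _ ≫ pullback.snd _ _)
        (by rw [pullback.condition_assoc, pullback.condition]; simp)
      hom_inv_id := by
        apply pullback.hom_ext <;> simp [pullback.lift_fst, pullback.lift_snd,
          pullback.lift_snd_assoc]
      inv_hom_id := by
        apply pullback.hom_ext
        · simp [pullback.lift_fst]
        · apply pullback.hom_ext <;> simp [pullback.lift_fst, pullback.lift_snd,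
            pullback.lift_fst_assoc, pullback.condition] }
  refine Functor.isLeftAdjoint_of_iso (F := F) (NatIso.ofComponents
    (fun X => Over.isoMk (e X) ?_) ?_)
  · change (e X).hom ≫ pullback.snd _ _ =
      pullback.lift (pullback.fst (X.hom ≫ g) f ≫ X.hom) (pullback.snd (X.hom ≫ g) f) _
    exact pullback.lift_snd _ _ _
  · intro X Y k
    ext
    change pullback.lift (pullback.fst (X.hom ≫ g) f ≫ k.left) (pullback.snd (X.hom ≫ g) f)
        (by simpa using pullback.condition) ≫ (e Y).hom =
      (e X).hom ≫ pullback.lift (pullback.fst X.hom (pullback.fst g f) ≫ k.left)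
        (pullback.snd X.hom (pullback.fst g f)) (by simpa using pullback.condition)
    apply pullback.hom_ext
    · simp [e, pullback.lift_fst, pullback.lift_fst_assoc]
    · apply pullback.hom_ext <;>
      simp [e, pullback.lift_fst, pullback.lift_snd, pullback.lift_fst_assoc,
        pullback.lift_snd_assoc]

theorem of_isPullback {B A C D : E} {f : B ⟶ A} (hf : Exponentiable f) {f' : D ⟶ C} {g : C ⟶ A}
    {g' : D ⟶ B} (h : IsPullback f' g' g f) : Exponentiable f' := by
  rw [← h.isoPullback_hom_fst]
  exact (of_isIso _).comp (hf.pullback_fst g)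

theorem prodMap [HasBinaryProducts E] {A B A' B' : E} {f : A ⟶ B} {g : A' ⟶ B'}
    (hf : Exponentiable f) (hg : Exponentiable g) : Exponentiable (prod.map f g) := by
  have h1 : IsPullback (prod.map f (𝟙 A')) prod.fst prod.fst f := by
    refine ⟨⟨by simp⟩, ⟨PullbackCone.IsLimit.mk _ (fun s => prod.lift s.snd (s.fst ≫ prod.snd))
      (fun s => ?_) (fun s => ?_) (fun s m h h' => ?_)⟩⟩
    · ext <;> simp [s.condition, prod.lift_fst, prod.lift_snd]
    · simp [prod.lift_fst, prod.lift_snd]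
    · ext <;> simp [← h, ← h', prod.lift_fst, prod.lift_snd]
  have h2 : IsPullback (prod.map (𝟙 B) g) prod.snd prod.snd g := by
    refine ⟨⟨by simp⟩, ⟨PullbackCone.IsLimit.mk _ (fun s => prod.lift (s.fst ≫ prod.fst) s.snd)
      (fun s => ?_) (fun s => ?_) (fun s m h h' => ?_)⟩⟩
    · ext <;> simp [s.condition, prod.lift_fst, prod.lift_snd]
    · simp [prod.lift_fst, prod.lift_snd]
    · ext <;> simp [← h, ← h', prod.lift_fst, prod.lift_snd]
  have := (hf.of_isPullback h1).comp (hg.of_isPullback h2)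
  simpa using this

end Exponentiable

/-- A polynomial in `E`: an exponentiable morphism `p : P_* ⟶ P`. -/
structure PolyCat (E : Type u) [Category.{v} E] [HasPullbacks E] where
  /-- the object `P` of positions -/
  base : E
  /-- the object `P_*` of directions -/
  total : E
  /-- the morphism `p` -/
  map : total ⟶ base
  exponentiable : Exponentiable map

namespace PolyCat

section Category

variable {E : Type u} [Category.{v} E] [HasPullbacks E]

/-- A morphism of polynomials `p ⟶ q`: a morphism `φ₁ : P ⟶ Q` together with a morphism
`φ♯ : P ×_Q Q_* ⟶ P_*` over `P`. The isomorphism class of such diagrams, over all choices of the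
pullback, has exactly one representative on the chosen pullback. -/
structure Hom (p q : PolyCat E) where
  /-- the component `φ₁` on positions -/
  pos : p.base ⟶ q.base
  /-- the component `φ♯` on directions -/
  dir : pullback pos q.map ⟶ p.total
  dir_map : dir ≫ p.map = pullback.fst pos q.map

/-- The action of `φ♯` on generalized elements: a position `b` of `p` and a direction `d` of `q` at
the position `φ₁ b` give a direction of `p` at `b`. -/
noncomputable def Hom.app {p q : PolyCat E} (φ : Hom p q) {Y : E} (b : Y ⟶ p.base)
    (d : Y ⟶ q.total) (h : b ≫ φ.pos = d ≫ q.map) : Y ⟶ p.total :=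
  pullback.lift b d h ≫ φ.dir

theorem Hom.app_map {p q : PolyCat E} (φ : Hom p q) {Y : E} (b : Y ⟶ p.base)
    (d : Y ⟶ q.total) (h : b ≫ φ.pos = d ≫ q.map) : φ.app b d h ≫ p.map = b := by
  rw [app, Category.assoc, φ.dir_map, pullback.lift_fst]

theorem Hom.comp_app {p q : PolyCat E} (φ : Hom p q) {Y Z : E} (y : Z ⟶ Y) (b : Y ⟶ p.base)
    (d : Y ⟶ q.total) (h : b ≫ φ.pos = d ≫ q.map) :
    y ≫ φ.app b d h = φ.app (y ≫ b) (y ≫ d) (by simp [h]) := by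
  rw [app, app, ← Category.assoc]
  congr 1
  apply pullback.hom_ext <;> simp [pullback.lift_fst, pullback.lift_snd]

theorem Hom.dir_eq_app {p q : PolyCat E} (φ : Hom p q) :
    φ.dir = φ.app (pullback.fst _ _) (pullback.snd _ _) pullback.condition := by
  rw [app, pullback.lift_fst_snd, Category.id_comp]

theorem Hom.app_mk {p q : PolyCat E} (f : p.base ⟶ q.base) (g : pullback f q.map ⟶ p.total)
    (w : g ≫ p.map = pullback.fst f q.map) {Y : E} (b : Y ⟶ p.base)
    (d : Y ⟶ q.total) (h : b ≫ f = d ≫ q.map) :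
    Hom.app ⟨f, g, w⟩ b d h = pullback.lift b d h ≫ g := rfl

theorem Hom.ext_app {p q : PolyCat E} {φ ψ : Hom p q} (h : φ.pos = ψ.pos)
    (h' : ∀ ⦃Y : E⦄ (b : Y ⟶ p.base) (d : Y ⟶ q.total) (hφ : b ≫ φ.pos = d ≫ q.map)
      (hψ : b ≫ ψ.pos = d ≫ q.map), φ.app b d hφ = ψ.app b d hψ) : φ = ψ := by
  obtain ⟨f, g, w⟩ := φ
  obtain ⟨f', g', w'⟩ := ψ
  obtain rfl : f = f' := h
  have := h' (pullback.fst _ _) (pullback.snd _ _) pullback.condition pullback.condition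
  rw [← Hom.dir_eq_app ⟨f, g, w⟩, ← Hom.dir_eq_app ⟨f, g', w'⟩] at this
  obtain rfl : g = g' := this
  rfl

/-- The identity morphism of a polynomial. -/
noncomputable def Hom.id (p : PolyCat E) : Hom p p where
  pos := 𝟙 p.base
  dir := pullback.snd (𝟙 p.base) p.map
  dir_map := by rw [← pullback.condition, Category.comp_id]

/-- The composite of morphisms of polynomials `φ : p ⟶ q` and `ψ : q ⟶ r`. On directions it is
`P ×_R R_* ≅ P ×_Q (Q ×_R R_*) ⟶ P ×_Q Q_* ⟶ P_*`. -/
noncomputable def Hom.comp {p q r : PolyCat E} (φ : Hom p q) (ψ : Hom q r) : Hom p r where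
  pos := φ.pos ≫ ψ.pos
  dir := φ.app (pullback.fst (φ.pos ≫ ψ.pos) r.map)
    (ψ.app (pullback.fst (φ.pos ≫ ψ.pos) r.map ≫ φ.pos) (pullback.snd (φ.pos ≫ ψ.pos) r.map)
      (by rw [Category.assoc, pullback.condition]))
    (by rw [Hom.app_map])
  dir_map := Hom.app_map _ _ _ _

noncomputable instance : CategoryStruct (PolyCat E) where
  Hom := Hom
  id := Hom.id
  comp := Hom.comp

@[simp]
theorem id_pos (p : PolyCat E) : Hom.pos (𝟙 p) = 𝟙 p.base := rfl

@[simp]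
theorem comp_pos {p q r : PolyCat E} (φ : p ⟶ q) (ψ : q ⟶ r) :
    Hom.pos (φ ≫ ψ) = Hom.pos φ ≫ Hom.pos ψ := rfl

theorem id_app (p : PolyCat E) {Y : E} (b : Y ⟶ p.base) (d : Y ⟶ p.total)
    (h : b ≫ Hom.pos (𝟙 p) = d ≫ p.map) : Hom.app (𝟙 p) b d h = d :=
  pullback.lift_snd _ _ _

theorem comp_app {p q r : PolyCat E} (φ : p ⟶ q) (ψ : q ⟶ r) {Y : E} (b : Y ⟶ p.base)
    (d : Y ⟶ r.total) (h : b ≫ Hom.pos (φ ≫ ψ) = d ≫ r.map) :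
    Hom.app (φ ≫ ψ) b d h =
      Hom.app φ b (Hom.app ψ (b ≫ Hom.pos φ) d (by simpa using h)) (by rw [Hom.app_map]) := by
  change pullback.lift b d h ≫ Hom.app φ _ _ _ = _
  refine (Hom.comp_app _ _ _ _ _).trans ?_
  congr 1
  · exact pullback.lift_fst _ _ _
  · refine (Hom.comp_app _ _ _ _ _).trans ?_
    congr 1
    · exact pullback.lift_fst_assoc _ _ _ _
    · exact pullback.lift_snd _ _ _

noncomputable instance : Category (PolyCat E) where
  id_comp φ := by
    refine Hom.ext_app (by simp) fun Y b d h h' => ?_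
    rw [comp_app, id_app]
    congr 1
    simp
  comp_id φ := by
    refine Hom.ext_app (by simp) fun Y b d h h' => ?_
    rw [comp_app]
    congr 1
    rw [id_app]
  assoc φ ψ χ := by
    refine Hom.ext_app (by simp) fun Y b d h h' => ?_
    simp only [comp_app]
    congr 2
    simp

/-- The invertible (cartesian) morphism of polynomials given by an isomorphism of arrows. -/
noncomputable def isoOfArrowIso {p q : PolyCat E} (e : p.base ≅ q.base) (e' : p.total ≅ q.total)
    (w : e'.hom ≫ q.map = p.map ≫ e.hom) : p ≅ q where
  hom :=
    { pos := e.hom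
      dir := pullback.snd e.hom q.map ≫ e'.inv
      dir_map := by
        rw [← cancel_mono e.hom]
        simp [← w, pullback.condition] }
  inv :=
    { pos := e.inv
      dir := pullback.snd e.inv p.map ≫ e'.hom
      dir_map := by
        rw [← cancel_mono e.inv]
        simp [w, pullback.condition] }
  hom_inv_id := by
    refine Hom.ext_app (by simp) fun Y b d h h' => ?_
    simp only [comp_app, id_app, Hom.app_mk]
    simp [pullback.lift_snd_assoc]
  inv_hom_id := by
    refine Hom.ext_app (by simp) fun Y b d h h' => ?_
    simp only [comp_app, id_app, Hom.app_mk]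
    simp [pullback.lift_snd_assoc]

end Category

section Monoidal

variable {E : Type u} [Category.{v} E] [HasFiniteLimits E]

/-- The identity polynomial `y`, the identity of the terminal object. -/
noncomputable abbrev y : PolyCat E where
  base := ⊤_ E
  total := ⊤_ E
  map := 𝟙 _
  exponentiable := .of_isIso _

/-! ### The Dirichlet tensor product -/

/-- The tensor product `P_* × Q_* ⟶ P × Q`. -/
noncomputable abbrev tensor (p q : PolyCat E) : PolyCat E where
  base := p.base ⨯ q.base
  total := p.total ⨯ q.total
  map := prod.map p.map q.map
  exponentiable := p.exponentiable.prodMap q.exponentiable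

/-- The tensor product of morphisms, `φ₁ × ψ₁` on positions and `φ♯ × ψ♯` on directions (along
`(P × Q) ×_{P' × Q'} (P'_* × Q'_*) ≅ (P ×_{P'} P'_*) × (Q ×_{Q'} Q'_*)`). -/
noncomputable def tensorMap {p p' q q' : PolyCat E} (φ : p ⟶ p') (ψ : q ⟶ q') :
    tensor p q ⟶ tensor p' q' where
  pos := prod.map φ.pos ψ.pos
  dir := prod.lift
    (φ.app (pullback.fst (prod.map φ.pos ψ.pos) (prod.map p'.map q'.map) ≫ prod.fst)
      (pullback.snd (prod.map φ.pos ψ.pos) (prod.map p'.map q'.map) ≫ prod.fst)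
      (by simpa using (pullback.condition (f := prod.map φ.pos ψ.pos)
        (g := prod.map p'.map q'.map)) =≫ prod.fst))
    (ψ.app (pullback.fst (prod.map φ.pos ψ.pos) (prod.map p'.map q'.map) ≫ prod.snd)
      (pullback.snd (prod.map φ.pos ψ.pos) (prod.map p'.map q'.map) ≫ prod.snd)
      (by simpa using (pullback.condition (f := prod.map φ.pos ψ.pos)
        (g := prod.map p'.map q'.map)) =≫ prod.snd))
  dir_map := by
    apply Limits.prod.hom_ext <;> simp [Hom.app_map, prod.lift_fst, prod.lift_snd]

/-- The associator of the tensor product, induced by the associativity of products. -/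
noncomputable def tensorAssoc (p q r : PolyCat E) :
    tensor (tensor p q) r ≅ tensor p (tensor q r) :=
  isoOfArrowIso (prod.associator p.base q.base r.base) (prod.associator p.total q.total r.total)
    (by simp)

/-- The left unitor of the tensor product, induced by `1 × A ≅ A`. -/
noncomputable def tensorLeftUnitor (p : PolyCat E) : tensor y p ≅ p :=
  isoOfArrowIso (prod.leftUnitor p.base) (prod.leftUnitor p.total)
    (prod.map_snd _ _).symm

/-- The right unitor of the tensor product, induced by `A × 1 ≅ A`. -/
noncomputable def tensorRightUnitor (p : PolyCat E) : tensor p y ≅ p :=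
  isoOfArrowIso (prod.rightUnitor p.base) (prod.rightUnitor p.total)
    (prod.map_fst _ _).symm

/-! ### The composition product -/

/-- The right adjoint `Π_p` of the pullback functor `Δ_p`. -/
noncomputable def push (p : PolyCat E) : Over p.total ⥤ Over p.base :=
  have : (Over.pullback p.map).IsLeftAdjoint := p.exponentiable
  (Over.pullback p.map).rightAdjoint

/-- The adjunction `Δ_p ⊣ Π_p`. -/
noncomputable def adj (p : PolyCat E) : Over.pullback p.map ⊣ p.push :=
  have : (Over.pullback p.map).IsLeftAdjoint := p.exponentiable
  Adjunction.ofIsLeftAdjoint (Over.pullback p.map)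

/-- The projection `Q × P_* ⟶ P_*` as an object over `P_*`. -/
noncomputable abbrev triOver (p q : PolyCat E) : Over p.total :=
  Over.mk (prod.snd : q.base ⨯ p.total ⟶ p.total)

/-- The object `Π_p (Q × P_*)` of positions of `p ◁ q`. -/
noncomputable def triBase (p q : PolyCat E) : E := (p.push.obj (triOver p q)).left

/-- The structure morphism `Π_p (Q × P_*) ⟶ P`. -/
noncomputable def triProj (p q : PolyCat E) : triBase p q ⟶ p.base := (p.push.obj (triOver p q)).hom

/-- The composite `Π_p (Q × P_*) ×_P P_* ⟶ Q × P_* ⟶ Q` of the counit of `Δ_p ⊣ Π_p` and the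
projection. -/
noncomputable def triEval (p q : PolyCat E) : pullback (triProj p q) p.map ⟶ q.base :=
  Over.Hom.left (p.adj.counit.app (triOver p q)) ≫ prod.fst

/-- `triEval` on generalized elements: a position `c` of `p ◁ q` and a direction `a` of `p` at the
position below `c` give a position of `q`. -/
noncomputable def eval {p q : PolyCat E} {Y : E} (c : Y ⟶ triBase p q) (a : Y ⟶ p.total)
    (h : c ≫ triProj p q = a ≫ p.map) : Y ⟶ q.base :=
  pullback.lift c a h ≫ triEval p q

theorem comp_eval {p q : PolyCat E} {Y Z : E} (y : Z ⟶ Y) (c : Y ⟶ triBase p q) (a : Y ⟶ p.total)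
    (h : c ≫ triProj p q = a ≫ p.map) :
    y ≫ eval c a h = eval (y ≫ c) (y ≫ a) (by simp [h]) := by
  rw [eval, eval, ← Category.assoc]
  congr 1
  apply pullback.hom_ext <;> simp [pullback.lift_fst, pullback.lift_snd]

theorem eval_congr {p q : PolyCat E} {Y : E} {c c' : Y ⟶ triBase p q} {a a' : Y ⟶ p.total}
    (hc : c = c') (ha : a = a') (h : c ≫ triProj p q = a ≫ p.map) :
    eval c a h = eval c' a' (by rw [← hc, h, ha]) := by
  subst hc ha
  rfl

/-- The universal property of `Π_p (Q × P_*)`: a morphism `b : Y ⟶ P` and a morphism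
`u : Y ×_P P_* ⟶ Q` determine a morphism `Y ⟶ Π_p (Q × P_*)`. -/
noncomputable def mkPos {p q : PolyCat E} {Y : E} (b : Y ⟶ p.base)
    (u : pullback b p.map ⟶ q.base) : Y ⟶ triBase p q :=
  Over.Hom.left (p.adj.homEquiv (Over.mk b) (triOver p q)
    (Over.homMk (prod.lift u (pullback.snd b p.map)) (prod.lift_snd _ _)))

@[simp]
theorem mkPos_proj {p q : PolyCat E} {Y : E} (b : Y ⟶ p.base) (u : pullback b p.map ⟶ q.base) :
    mkPos b u ≫ triProj p q = b :=
  Over.w (p.adj.homEquiv (Over.mk b) (triOver p q)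
    (Over.homMk (prod.lift u (pullback.snd b p.map)) (prod.lift_snd _ _)))

theorem eval_mkPos {p q : PolyCat E} {Y Z : E} (b : Y ⟶ p.base) (u : pullback b p.map ⟶ q.base)
    (x : Z ⟶ Y) (a : Z ⟶ p.total) (h : (x ≫ mkPos b u) ≫ triProj p q = a ≫ p.map) :
    eval (x ≫ mkPos b u) a h = pullback.lift x a (by simpa using h) ≫ u := by
  have key := (p.adj.homEquiv_counit (X := Over.mk b) (Y := triOver p q)
    (g := p.adj.homEquiv (Over.mk b) (triOver p q)
      (Over.homMk (prod.lift u (pullback.snd b p.map)) (prod.lift_snd _ _)))).symm.trans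
    (Equiv.symm_apply_apply _ _)
  have hu : pullback.lift (pullback.fst b p.map ≫ mkPos b u) (pullback.snd b p.map)
      (by rw [Category.assoc, mkPos_proj, pullback.condition]) ≫ triEval p q = u :=
    ((Category.assoc _ _ _).symm.trans (congrArg (fun k => Over.Hom.left k ≫ prod.fst) key)).trans
      (prod.lift_fst _ _)
  refine Eq.trans ?_ (congrArg (fun k => pullback.lift x a (by simpa using h) ≫ k) hu)
  rw [eval, ← Category.assoc]
  congr 1
  apply pullback.hom_ext <;>
    simp [pullback.lift_fst, pullback.lift_snd, pullback.lift_fst_assoc]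

/-- Two morphisms into `Π_p (Q × P_*)` are equal if they agree on generalized elements. -/
theorem pos_ext {p q : PolyCat E} {Y : E} {c c' : Y ⟶ triBase p q}
    (h : c ≫ triProj p q = c' ≫ triProj p q)
    (h' : ∀ ⦃Z : E⦄ (x : Z ⟶ Y) (a : Z ⟶ p.total) (hc : (x ≫ c) ≫ triProj p q = a ≫ p.map)
      (hc' : (x ≫ c') ≫ triProj p q = a ≫ p.map), eval (x ≫ c) a hc = eval (x ≫ c') a hc') :
    c = c' := by
  let b := c' ≫ triProj p q
  let k : Over.mk b ⟶ p.push.obj (triOver p q) := Over.homMk c h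
  let k' : Over.mk b ⟶ p.push.obj (triOver p q) := Over.homMk c' rfl
  suffices hk : k = k' from congrArg (fun k => Over.Hom.left k) hk
  apply (p.adj.homEquiv _ _).symm.injective
  rw [Adjunction.homEquiv_counit, Adjunction.homEquiv_counit]
  apply Over.OverMorphism.ext
  apply Limits.prod.hom_ext
  · have key := h' (pullback.fst b p.map) (pullback.snd b p.map)
      (by rw [Category.assoc, h, ← pullback.condition]) 
      (by rw [Category.assoc, ← pullback.condition])
    exact (Category.assoc _ _ _).trans (key.trans (Category.assoc _ _ _).symm)
  · exact (Over.w ((Over.pullback p.map).map k ≫ p.adj.counit.app (triOver p q))).trans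
      (Over.w ((Over.pullback p.map).map k' ≫ p.adj.counit.app (triOver p q))).symm

/-- The object `(Π_p (Q × P_*) ×_P P_*) ×_Q Q_*` of directions of `p ◁ q`. -/
noncomputable def triTotal (p q : PolyCat E) : E := pullback (triEval p q) q.map

/-- The projection `(Π_p (Q × P_*) ×_P P_*) ×_Q Q_* ⟶ Π_p (Q × P_*) ×_P P_*`. -/
noncomputable def triTop (p q : PolyCat E) : triTotal p q ⟶ pullback (triProj p q) p.map :=
  pullback.fst (triEval p q) q.map

/-- The composite `(Π_p (Q × P_*) ×_P P_*) ×_Q Q_* ⟶ Π_p (Q × P_*) ×_P P_* ⟶ Π_p (Q × P_*)`. -/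
noncomputable def triHom (p q : PolyCat E) : triTotal p q ⟶ triBase p q :=
  triTop p q ≫ pullback.fst (triProj p q) p.map

/-- The composition product `p ◁ q`. -/
noncomputable abbrev tri (p q : PolyCat E) : PolyCat E where
  base := triBase p q
  total := triTotal p q
  map := triHom p q
  exponentiable :=
    (q.exponentiable.pullback_fst (triEval p q)).comp (p.exponentiable.pullback_fst (triProj p q))

/-- The projection of the directions of `p ◁ q` to those of `p`. -/
noncomputable def dirFst (p q : PolyCat E) : triTotal p q ⟶ p.total :=
  triTop p q ≫ pullback.snd (triProj p q) p.map

/-- The projection of the directions of `p ◁ q` to those of `q`. -/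
noncomputable def dirSnd (p q : PolyCat E) : triTotal p q ⟶ q.total :=
  pullback.snd (triEval p q) q.map

/-- A generalized element of the directions of `p ◁ q`: a position `c` of `p ◁ q`, a direction `a`
of `p` below it, and a direction `d` of `q` at the position selected by `c` and `a`. -/
noncomputable def mkDir {p q : PolyCat E} {Y : E} (c : Y ⟶ triBase p q) (a : Y ⟶ p.total)
    (h : c ≫ triProj p q = a ≫ p.map) (d : Y ⟶ q.total) (h' : eval c a h = d ≫ q.map) :
    Y ⟶ triTotal p q :=
  pullback.lift (pullback.lift c a h) d h'

section

variable {p q : PolyCat E} {Y : E}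

theorem triHom_proj (p q : PolyCat E) :
    triHom p q ≫ triProj p q = dirFst p q ≫ p.map := by
  rw [triHom, dirFst, Category.assoc, Category.assoc, pullback.condition]

theorem dir_proj (e : Y ⟶ triTotal p q) :
    (e ≫ triHom p q) ≫ triProj p q = (e ≫ dirFst p q) ≫ p.map := by
  rw [Category.assoc, triHom_proj, Category.assoc]

theorem dir_eval (e : Y ⟶ triTotal p q) :
    eval (e ≫ triHom p q) (e ≫ dirFst p q) (dir_proj e) = (e ≫ dirSnd p q) ≫ q.map := by
  have : pullback.lift (e ≫ triHom p q) (e ≫ dirFst p q) (dir_proj e) =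
      e ≫ triTop p q := by
    apply pullback.hom_ext <;> simp [pullback.lift_fst, pullback.lift_snd, triHom, dirFst]
  have h : triTop p q ≫ triEval p q = dirSnd p q ≫ q.map := pullback.condition
  rw [eval, this, Category.assoc, Category.assoc, h]

variable (c : Y ⟶ triBase p q) (a : Y ⟶ p.total)
    (h : c ≫ triProj p q = a ≫ p.map) (d : Y ⟶ q.total) (h' : eval c a h = d ≫ q.map)

@[simp]
theorem mkDir_hom : mkDir c a h d h' ≫ triHom p q = c :=
  (pullback.lift_fst_assoc _ _ _ _).trans (pullback.lift_fst _ _ _)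

@[simp]
theorem mkDir_fst : mkDir c a h d h' ≫ dirFst p q = a :=
  (pullback.lift_fst_assoc _ _ _ _).trans (pullback.lift_snd _ _ _)

@[simp]
theorem mkDir_snd : mkDir c a h d h' ≫ dirSnd p q = d :=
  pullback.lift_snd _ _ _

theorem dir_ext {e e' : Y ⟶ triTotal p q} (h₀ : e ≫ triHom p q = e' ≫ triHom p q)
    (h₁ : e ≫ dirFst p q = e' ≫ dirFst p q) (h₂ : e ≫ dirSnd p q = e' ≫ dirSnd p q) :
    e = e' := by
  refine pullback.hom_ext (?_ : e ≫ triTop p q = e' ≫ triTop p q) ?_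
  · apply pullback.hom_ext
    · simpa [triHom] using h₀
    · simpa [dirFst] using h₁
  · exact h₂

end

/-- The composition product of morphisms on positions: `(b, u)` is sent to `φ₁ b` together with the
composite of `φ♯`, `u` and `ψ₁`. -/
noncomputable def triMapPos {p p' q q' : PolyCat E} (φ : p ⟶ p') (ψ : q ⟶ q') :
    triBase p q ⟶ triBase p' q' :=
  mkPos (triProj p q ≫ φ.pos)
    (eval (pullback.fst (triProj p q ≫ φ.pos) p'.map)
      (φ.app (pullback.fst (triProj p q ≫ φ.pos) p'.map ≫ triProj p q)
        (pullback.snd (triProj p q ≫ φ.pos) p'.map)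
        (by rw [Category.assoc, pullback.condition]))
      (by rw [Hom.app_map]) ≫ ψ.pos)

@[simp]
theorem triMapPos_proj {p p' q q' : PolyCat E} (φ : p ⟶ p') (ψ : q ⟶ q') :
    triMapPos φ ψ ≫ triProj p' q' = triProj p q ≫ φ.pos :=
  mkPos_proj _ _

theorem eval_triMapPos {p p' q q' : PolyCat E} (φ : p ⟶ p') (ψ : q ⟶ q') {Y : E}
    (c : Y ⟶ triBase p q) (a : Y ⟶ p'.total)
    (h : (c ≫ triMapPos φ ψ) ≫ triProj p' q' = a ≫ p'.map) :
    eval (c ≫ triMapPos φ ψ) a h =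
      eval c (φ.app (c ≫ triProj p q) a (by simpa using h)) (by rw [Hom.app_map]) ≫ ψ.pos := by
  refine (eval_mkPos _ _ _ _ _).trans ?_
  rw [← Category.assoc, comp_eval]
  congr 2
  · rw [pullback.lift_fst]
  · rw [Hom.comp_app]
    congr 1
    · rw [pullback.lift_fst_assoc]
    · rw [pullback.lift_snd]

/-- The composition product of morphisms: `triMapPos` on positions, and on directions
`(a, d) ↦ (φ♯ a, ψ♯ d)`. -/
noncomputable def triMap {p p' q q' : PolyCat E} (φ : p ⟶ p') (ψ : q ⟶ q') :
    tri p q ⟶ tri p' q' where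
  pos := triMapPos φ ψ
  dir :=
    have w₁ := (pullback.condition (f := triMapPos φ ψ) (g := triHom p' q'))
    have w₂ : (pullback.fst (triMapPos φ ψ) (triHom p' q') ≫ triProj p q) ≫ φ.pos =
        (pullback.snd (triMapPos φ ψ) (triHom p' q') ≫ dirFst p' q') ≫ p'.map := by
      simpa [triHom_proj] using w₁ =≫ triProj p' q'
    mkDir (pullback.fst (triMapPos φ ψ) (triHom p' q'))
      (φ.app (pullback.fst (triMapPos φ ψ) (triHom p' q') ≫ triProj p q)
        (pullback.snd (triMapPos φ ψ) (triHom p' q') ≫ dirFst p' q') w₂)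
      (by rw [Hom.app_map])
      (ψ.app
        (eval (pullback.fst (triMapPos φ ψ) (triHom p' q'))
          (φ.app (pullback.fst (triMapPos φ ψ) (triHom p' q') ≫ triProj p q)
            (pullback.snd (triMapPos φ ψ) (triHom p' q') ≫ dirFst p' q') w₂)
          (by rw [Hom.app_map]))
        (pullback.snd (triMapPos φ ψ) (triHom p' q') ≫ dirSnd p' q')
        (by
          rw [← dir_eval]
          exact (eval_triMapPos φ ψ _ _ (by rw [w₁, dir_proj])).symm.trans
            (eval_congr w₁ rfl _)))
      (Hom.app_map _ _ _ _).symm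
  dir_map := mkDir_hom _ _ _ _ _

/-! #### Unitors -/

/-- The morphism `Π_1 (P × 1) ⟶ P` selecting the position of `p` at the only direction of `y`. -/
noncomputable def triLeftBase (p : PolyCat E) : triBase y p ⟶ p.base :=
  eval (p := y) (q := p) (𝟙 _) (terminal.from _) (terminal.hom_ext _ _)

theorem comp_triLeftBase (p : PolyCat E) {Y : E} (c : Y ⟶ triBase y p) (a : Y ⟶ ⊤_ E)
    (h : c ≫ triProj y p = a ≫ 𝟙 _) : c ≫ triLeftBase p = eval (p := y) (q := p) c a h :=
  (comp_eval _ _ _ _).trans (eval_congr (Category.comp_id _) (terminal.hom_ext _ _) _)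

/-- The inverse of `triLeftBase`. -/
noncomputable def triLeftBaseInv (p : PolyCat E) : p.base ⟶ triBase y p :=
  mkPos (p := y) (q := p) (terminal.from _) (pullback.fst _ _)

theorem eval_triLeftBaseInv (p : PolyCat E) {Y : E} (b : Y ⟶ p.base) (a : Y ⟶ ⊤_ E)
    (h : (b ≫ triLeftBaseInv p) ≫ triProj y p = a ≫ 𝟙 _) :
    eval (p := y) (q := p) (b ≫ triLeftBaseInv p) a h = b :=
  (eval_mkPos (p := y) (q := p) _ _ _ _ _).trans (pullback.lift_fst _ _ _)

theorem triLeft_comm (p : PolyCat E) :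
    dirSnd y p ≫ p.map = triHom y p ≫ triLeftBase p := by
  refine (congrArg (· ≫ p.map) (Category.id_comp (dirSnd y p))).symm.trans
    ((dir_eval (𝟙 (triTotal y p))).symm.trans ?_)
  rw [comp_triLeftBase p _ (𝟙 _ ≫ dirFst y p) (terminal.hom_ext _ _)]
  exact eval_congr (Category.id_comp _) rfl _

/-- The isomorphism `triLeftBase`. -/
noncomputable def triLeftBaseIso (p : PolyCat E) : triBase y p ≅ p.base where
  hom := triLeftBase p
  inv := triLeftBaseInv p
  hom_inv_id := by
    refine pos_ext (p := y) (q := p) (terminal.hom_ext _ _) fun Z x a hc hc' => ?_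
    refine (eval_congr (Category.assoc _ _ _).symm rfl hc).trans
      ((eval_triLeftBaseInv p _ a (terminal.hom_ext _ _)).trans ?_)
    exact (comp_triLeftBase p x a (terminal.hom_ext _ _)).trans
      (eval_congr (Category.comp_id _).symm rfl _)
  inv_hom_id := by
    rw [comp_triLeftBase p _ (terminal.from _) (terminal.hom_ext _ _)]
    exact (eval_congr (Category.id_comp _).symm rfl _).trans
      (eval_triLeftBaseInv p (𝟙 _) _ (terminal.hom_ext _ _))

/-- The isomorphism `(Π_1 (P × 1) ×_1 1) ×_P P_* ≅ P_*`. -/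
noncomputable def triLeftTotalIso (p : PolyCat E) : triTotal y p ≅ p.total where
  hom := dirSnd y p
  inv := mkDir (p := y) (q := p) (p.map ≫ triLeftBaseInv p) (terminal.from _)
    (terminal.hom_ext _ _) (𝟙 _) (by
      rw [Category.id_comp]
      exact eval_triLeftBaseInv p p.map _ (terminal.hom_ext _ _))
  hom_inv_id := by
    apply dir_ext
    · rw [Category.assoc, mkDir_hom, Category.id_comp, ← Category.assoc, triLeft_comm,
        Category.assoc]
      exact (congrArg (triHom y p ≫ ·) (triLeftBaseIso p).hom_inv_id).trans (Category.comp_id _)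
    · exact terminal.hom_ext _ _
    · rw [Category.assoc, mkDir_snd, Category.comp_id, Category.id_comp]
  inv_hom_id := mkDir_snd _ _ _ _ _

/-- The left unitor `y ◁ p ≅ p`. -/
noncomputable def triLeftUnitor (p : PolyCat E) : tri y p ≅ p :=
  isoOfArrowIso (triLeftBaseIso p) (triLeftTotalIso p) (triLeft_comm p)

/-- The inverse of the isomorphism `Π_p (1 × P_*) ⟶ P`. -/
noncomputable def triRightBaseInv (p : PolyCat E) : p.base ⟶ triBase p y :=
  mkPos (p := p) (q := y) (𝟙 _) (terminal.from _)

/-- The isomorphism `Π_p (1 × P_*) ≅ P`. -/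
noncomputable def triRightBaseIso (p : PolyCat E) : triBase p y ≅ p.base where
  hom := triProj p y
  inv := triRightBaseInv p
  hom_inv_id := by
    refine pos_ext ?_ fun Z x a hc hc' => terminal.hom_ext _ _
    rw [Category.assoc, triRightBaseInv, mkPos_proj, Category.comp_id, Category.id_comp]
  inv_hom_id := mkPos_proj _ _

/-- The isomorphism `(Π_p (1 × P_*) ×_P P_*) ×_1 1 ≅ P_*`. -/
noncomputable def triRightTotalIso (p : PolyCat E) : triTotal p y ≅ p.total where
  hom := dirFst p y
  inv := mkDir (p := p) (q := y) (p.map ≫ triRightBaseInv p) (𝟙 _)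
    (by rw [Category.assoc, triRightBaseInv, mkPos_proj, Category.comp_id, Category.id_comp])
    (terminal.from _) (terminal.hom_ext _ _)
  hom_inv_id := by
    apply dir_ext
    · rw [Category.assoc, mkDir_hom, Category.id_comp, ← Category.assoc, ← triHom_proj,
        Category.assoc]
      exact (congrArg (triHom p y ≫ ·) (triRightBaseIso p).hom_inv_id).trans (Category.comp_id _)
    · rw [Category.assoc, mkDir_fst, Category.comp_id, Category.id_comp]
    · exact terminal.hom_ext _ _
  inv_hom_id := mkDir_fst _ _ _ _ _

/-- The right unitor `p ◁ y ≅ p`. -/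
noncomputable def triRightUnitor (p : PolyCat E) : tri p y ≅ p :=
  isoOfArrowIso (triRightBaseIso p) (triRightTotalIso p) (triHom_proj p y).symm

/-! #### Associator -/

section Assoc

variable (p q r : PolyCat E)

/-- The position of `p` below a position of `(p ◁ q) ◁ r`. -/
noncomputable def assocP : triBase (tri p q) r ⟶ p.base :=
  triProj (tri p q) r ≫ triProj p q

/-- The position of `q` given by a position of `(p ◁ q) ◁ r` and a direction of `p`. -/
noncomputable def assocQ : pullback (assocP p q r) p.map ⟶ q.base :=
  eval (pullback.fst (assocP p q r) p.map ≫ triProj (tri p q) r)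
    (pullback.snd (assocP p q r) p.map)
    (by rw [← pullback.condition, assocP, Category.assoc])

variable {p q r}

theorem lift_assocQ {Y : E} (c : Y ⟶ triBase (tri p q) r) (a : Y ⟶ p.total)
    (h : c ≫ assocP p q r = a ≫ p.map) :
    pullback.lift c a h ≫ assocQ p q r =
      eval (c ≫ triProj (tri p q) r) a (by rw [Category.assoc]; exact h) :=
  (comp_eval _ _ _ _).trans
    (eval_congr (pullback.lift_fst_assoc _ _ _ _) (pullback.lift_snd _ _ _) _)

variable (p q r)

/-- The position of `r` given by a position of `(p ◁ q) ◁ r`, a direction of `p` and a direction of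
`q`. -/
noncomputable def assocR : pullback (assocQ p q r) q.map ⟶ r.base :=
  eval (p := tri p q) (q := r)
    (pullback.fst (assocQ p q r) q.map ≫ pullback.fst (assocP p q r) p.map)
    (mkDir
      ((pullback.fst (assocQ p q r) q.map ≫ pullback.fst (assocP p q r) p.map) ≫
        triProj (tri p q) r)
      (pullback.fst (assocQ p q r) q.map ≫ pullback.snd (assocP p q r) p.map)
      (by
        simpa only [Category.assoc, assocP] using
          pullback.fst (assocQ p q r) q.map ≫= pullback.condition (f := assocP p q r) (g := p.map))
      (pullback.snd (assocQ p q r) q.map)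
      (((comp_eval _ _ _ _).trans (eval_congr (Category.assoc _ _ _).symm rfl _)).symm.trans
        (pullback.condition (f := assocQ p q r) (g := q.map))))
    (mkDir_hom _ _ _ _ _).symm

variable {p q r}

theorem lift_assocR {Y : E} (c : Y ⟶ triBase (tri p q) r) (a : Y ⟶ p.total)
    (h : c ≫ assocP p q r = a ≫ p.map) (d : Y ⟶ q.total)
    (h' : pullback.lift c a h ≫ assocQ p q r = d ≫ q.map) :
    pullback.lift (pullback.lift c a h) d h' ≫ assocR p q r =
      eval (p := tri p q) c
        (mkDir (c ≫ triProj (tri p q) r) a (by rw [Category.assoc]; exact h) d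
          ((lift_assocQ c a h).symm.trans h'))
        (mkDir_hom _ _ _ _ _).symm := by
  refine (comp_eval _ _ _ _).trans (eval_congr ?_ ?_ _)
  · rw [pullback.lift_fst_assoc, pullback.lift_fst]
  · apply dir_ext <;>
      simp [pullback.lift_fst, pullback.lift_snd, pullback.lift_fst_assoc]

variable (p q r)

/-- The associator on positions. -/
noncomputable def assocPos : triBase (tri p q) r ⟶ triBase p (tri q r) :=
  mkPos (q := tri q r) (assocP p q r) (mkPos (assocQ p q r) (assocR p q r))

variable {p q r}

theorem assocPos_proj : assocPos p q r ≫ triProj p (tri q r) = assocP p q r := mkPos_proj _ _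

theorem eval_assocPos {Y : E} (c : Y ⟶ triBase (tri p q) r) (a : Y ⟶ p.total)
    (h : (c ≫ assocPos p q r) ≫ triProj p (tri q r) = a ≫ p.map) :
    eval (q := tri q r) (c ≫ assocPos p q r) a h =
      pullback.lift c a (by rw [← h, Category.assoc, assocPos_proj]) ≫
        mkPos (assocQ p q r) (assocR p q r) :=
  eval_mkPos _ _ _ _ _

theorem eval_assocPos_proj {Y : E} (c : Y ⟶ triBase (tri p q) r) (a : Y ⟶ p.total)
    (h : (c ≫ assocPos p q r) ≫ triProj p (tri q r) = a ≫ p.map) :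
    eval (q := tri q r) (c ≫ assocPos p q r) a h ≫ triProj q r =
      eval (c ≫ triProj (tri p q) r) a
        (by rw [← h, Category.assoc, Category.assoc, assocPos_proj, assocP]) := by
  rw [eval_assocPos, Category.assoc, mkPos_proj, lift_assocQ]

theorem eval_eval_assocPos {Y : E} (c : Y ⟶ triBase (tri p q) r) (a : Y ⟶ p.total)
    (h : (c ≫ assocPos p q r) ≫ triProj p (tri q r) = a ≫ p.map) (d : Y ⟶ q.total)
    (h' : eval (q := tri q r) (c ≫ assocPos p q r) a h ≫ triProj q r = d ≫ q.map) :
    eval (eval (q := tri q r) (c ≫ assocPos p q r) a h) d h' =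
      eval (p := tri p q) c
        (mkDir (c ≫ triProj (tri p q) r) a
          (by rw [← h, Category.assoc, Category.assoc, assocPos_proj, assocP]) d
          ((eval_assocPos_proj c a h).symm.trans h'))
        (mkDir_hom _ _ _ _ _).symm := by
  refine (eval_congr (eval_assocPos c a h) rfl _).trans ?_
  rw [eval_mkPos, lift_assocR]

variable (p q r)

/-- The position of `p ◁ q` below a position of `p ◁ (q ◁ r)`. -/
noncomputable def assocInvPQ : triBase p (tri q r) ⟶ triBase p q :=
  mkPos (triProj p (tri q r)) (triEval p (tri q r) ≫ triProj q r)

variable {p q r}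

theorem assocInvPQ_proj : assocInvPQ p q r ≫ triProj p q = triProj p (tri q r) := mkPos_proj _ _

theorem eval_assocInvPQ {Y : E} (c : Y ⟶ triBase p (tri q r)) (a : Y ⟶ p.total)
    (h : (c ≫ assocInvPQ p q r) ≫ triProj p q = a ≫ p.map) :
    eval (c ≫ assocInvPQ p q r) a h =
      eval (q := tri q r) c a (by rw [← h, Category.assoc, assocInvPQ_proj]) ≫ triProj q r := by
  exact (eval_mkPos _ _ _ _ _).trans (Category.assoc _ _ _).symm

variable (p q r)

/-- The position of `r` given by a position of `p ◁ (q ◁ r)` and a direction of `p ◁ q`. -/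
noncomputable def assocInvR : pullback (assocInvPQ p q r) (triHom p q) ⟶ r.base :=
  have w := pullback.condition (f := assocInvPQ p q r) (g := triHom p q)
  eval
    (eval (q := tri q r) (pullback.fst (assocInvPQ p q r) (triHom p q))
      (pullback.snd (assocInvPQ p q r) (triHom p q) ≫ dirFst p q)
      (by rw [← dir_proj, ← w, Category.assoc, assocInvPQ_proj]))
    (pullback.snd (assocInvPQ p q r) (triHom p q) ≫ dirSnd p q)
    (by
      rw [← dir_eval]
      exact (eval_assocInvPQ _ _ (by rw [w, dir_proj])).symm.trans (eval_congr w rfl _))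

/-- The inverse of the associator on positions. -/
noncomputable def assocPosInv : triBase p (tri q r) ⟶ triBase (tri p q) r :=
  mkPos (p := tri p q) (assocInvPQ p q r) (assocInvR p q r)

variable {p q r}

theorem assocPosInv_proj : assocPosInv p q r ≫ triProj (tri p q) r = assocInvPQ p q r :=
  mkPos_proj _ _

theorem eval_assocPosInv {Y : E} (c : Y ⟶ triBase p (tri q r)) (e : Y ⟶ triTotal p q)
    (h : (c ≫ assocPosInv p q r) ≫ triProj (tri p q) r = e ≫ triHom p q)
    (w₁ : c ≫ triProj p (tri q r) = (e ≫ dirFst p q) ≫ p.map)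
    (w₂ : eval (q := tri q r) c (e ≫ dirFst p q) w₁ ≫ triProj q r = (e ≫ dirSnd p q) ≫ q.map) :
    eval (p := tri p q) (c ≫ assocPosInv p q r) e h =
      eval (eval (q := tri q r) c (e ≫ dirFst p q) w₁) (e ≫ dirSnd p q) w₂ := by
  refine (eval_mkPos (p := tri p q) _ _ _ _ _).trans ((comp_eval _ _ _ _).trans (eval_congr ?_ ?_ _))
  · refine (comp_eval _ _ _ _).trans (eval_congr ?_ ?_ _)
    · exact pullback.lift_fst _ _ _
    · exact pullback.lift_snd_assoc _ _ _ _
  · exact pullback.lift_snd_assoc _ _ _ _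

variable (p q r)

theorem assocPos_invPQ : assocPos p q r ≫ assocInvPQ p q r = triProj (tri p q) r := by
  refine pos_ext ?_ fun Z x a hc hc' => ?_
  · rw [Category.assoc, assocInvPQ_proj, assocPos_proj, assocP]
  · refine (eval_congr (Category.assoc _ _ _).symm rfl _).trans
      ((eval_assocInvPQ _ _ (by rw [← hc]; simp only [Category.assoc])).trans ?_)
    exact eval_assocPos_proj _ _ _

variable {p q r}

theorem assocPosInv_assocPos_proj :
    assocPosInv p q r ≫ assocPos p q r ≫ triProj p (tri q r) = triProj p (tri q r) := by
  rw [assocPos_proj, assocP, ← Category.assoc, assocPosInv_proj, assocInvPQ_proj]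

theorem eval_eval_assocPosInv {Y : E} (c : Y ⟶ triBase p (tri q r)) (a : Y ⟶ p.total)
    (h : ((c ≫ assocPosInv p q r) ≫ assocPos p q r) ≫ triProj p (tri q r) = a ≫ p.map)
    (h₁ : c ≫ triProj p (tri q r) = a ≫ p.map) (d : Y ⟶ q.total)
    (h' : eval (q := tri q r) ((c ≫ assocPosInv p q r) ≫ assocPos p q r) a h ≫ triProj q r =
      d ≫ q.map)
    (h₂ : eval (q := tri q r) c a h₁ ≫ triProj q r = d ≫ q.map) :
    eval (eval (q := tri q r) ((c ≫ assocPosInv p q r) ≫ assocPos p q r) a h) d h' =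
      eval (eval (q := tri q r) c a h₁) d h₂ := by
  rw [eval_eval_assocPos]
  generalize_proofs _ k₁ k₂ k₃
  have ha := mkDir_fst ((c ≫ assocPosInv p q r) ≫ triProj (tri p q) r) a k₁ d k₂
  have hd := mkDir_snd ((c ≫ assocPosInv p q r) ≫ triProj (tri p q) r) a k₁ d k₂
  generalize mkDir ((c ≫ assocPosInv p q r) ≫ triProj (tri p q) r) a k₁ d k₂ = e at ha hd k₃ ⊢
  subst ha hd
  exact eval_assocPosInv c e k₃ h₁ h₂

theorem eval_assocPosInv_assocPos {Y : E} (c : Y ⟶ triBase p (tri q r)) (a : Y ⟶ p.total)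
    (h : ((c ≫ assocPosInv p q r) ≫ assocPos p q r) ≫ triProj p (tri q r) = a ≫ p.map)
    (h₁ : c ≫ triProj p (tri q r) = a ≫ p.map) :
    eval (q := tri q r) ((c ≫ assocPosInv p q r) ≫ assocPos p q r) a h =
      eval (q := tri q r) c a h₁ := by
  refine pos_ext ?_ fun W z d hd hd' => ?_
  · rw [eval_assocPos_proj]
    refine (eval_congr (c' := c ≫ assocInvPQ p q r) ?_ rfl _).trans (eval_assocInvPQ _ _ _)
    rw [Category.assoc, assocPosInv_proj]
  · have e₁ : z ≫ eval (q := tri q r) ((c ≫ assocPosInv p q r) ≫ assocPos p q r) a h =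
        eval (q := tri q r) (((z ≫ c) ≫ assocPosInv p q r) ≫ assocPos p q r) (z ≫ a)
          (by simpa only [Category.assoc] using z ≫= h) :=
      (comp_eval (q := tri q r) _ _ _ _).trans
        (eval_congr (q := tri q r) (by simp only [Category.assoc]) rfl _)
    have e₂ : z ≫ eval (q := tri q r) c a h₁ = eval (q := tri q r) (z ≫ c) (z ≫ a)
        (by simpa only [Category.assoc] using z ≫= h₁) := comp_eval (q := tri q r) _ _ _ _
    refine (eval_congr e₁ rfl _).trans (Eq.trans ?_ (eval_congr e₂ rfl hd').symm)
    exact eval_eval_assocPosInv _ _ _ _ _ _ _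

variable (p q r)

theorem assocPos_hom_inv_id : assocPos p q r ≫ assocPosInv p q r = 𝟙 _ := by
  refine pos_ext (p := tri p q) ?_ fun Z x e hc hc' => ?_
  · rw [Category.assoc, assocPosInv_proj, assocPos_invPQ, Category.id_comp]
  · rw [Category.comp_id] at hc'
    have w₁ : (x ≫ assocPos p q r) ≫ triProj p (tri q r) = (e ≫ dirFst p q) ≫ p.map := by
      rw [Category.assoc, assocPos_proj, assocP, ← Category.assoc, hc', dir_proj]
    have w₂ : eval (q := tri q r) (x ≫ assocPos p q r) (e ≫ dirFst p q) w₁ ≫ triProj q r =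
        (e ≫ dirSnd p q) ≫ q.map := by
      rw [eval_assocPos_proj, ← dir_eval]
      exact eval_congr hc' rfl _
    refine (eval_congr (p := tri p q) (Category.assoc _ _ _).symm rfl _).trans
      ((eval_assocPosInv _ e (by rw [← hc]; simp only [Category.assoc]) w₁ w₂).trans
        ((eval_eval_assocPos _ _ w₁ _ w₂).trans
          (eval_congr (p := tri p q) (Category.comp_id _).symm ?_ _)))
    apply dir_ext <;> simp [hc']

theorem assocPos_inv_hom_id : assocPosInv p q r ≫ assocPos p q r = 𝟙 _ := by
  refine pos_ext (q := tri q r) ?_ fun Z x a hc hc' => ?_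
  · rw [Category.assoc, assocPosInv_assocPos_proj, Category.id_comp]
  · exact (eval_congr (q := tri q r) (Category.assoc _ _ _).symm rfl _).trans
      ((eval_assocPosInv_assocPos x a (by rw [← hc]; simp only [Category.assoc])
        (by rw [← hc', Category.comp_id])).trans
          (eval_congr (q := tri q r) (Category.comp_id _).symm rfl _))

/-- The isomorphism between the positions of `(p ◁ q) ◁ r` and of `p ◁ (q ◁ r)`. -/
noncomputable def assocPosIso : triBase (tri p q) r ≅ triBase p (tri q r) where
  hom := assocPos p q r
  inv := assocPosInv p q r
  hom_inv_id := assocPos_hom_inv_id p q r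
  inv_hom_id := assocPos_inv_hom_id p q r

/-- The associator on directions, `((a, d), s) ↦ (a, (d, s))`. -/
noncomputable def assocDir : triTotal (tri p q) r ⟶ triTotal p (tri q r) :=
  have w₁ : (triHom (tri p q) r ≫ assocPos p q r) ≫ triProj p (tri q r) =
      (dirFst (tri p q) r ≫ dirFst p q) ≫ p.map := by
    rw [Category.assoc, assocPos_proj, assocP, ← Category.assoc, triHom_proj, dir_proj]
  have w₂ : eval (q := tri q r) (triHom (tri p q) r ≫ assocPos p q r)
      (dirFst (tri p q) r ≫ dirFst p q) w₁ ≫ triProj q r =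
      (dirFst (tri p q) r ≫ dirSnd p q) ≫ q.map := by
    rw [eval_assocPos_proj, ← dir_eval]
    exact eval_congr (triHom_proj (tri p q) r) rfl _
  mkDir (q := tri q r) (triHom (tri p q) r ≫ assocPos p q r)
    (dirFst (tri p q) r ≫ dirFst p q) w₁
    (mkDir
      (eval (q := tri q r) (triHom (tri p q) r ≫ assocPos p q r)
        (dirFst (tri p q) r ≫ dirFst p q) w₁)
      (dirFst (tri p q) r ≫ dirSnd p q) w₂ (dirSnd (tri p q) r)
      (by
        refine (eval_eval_assocPos _ _ _ _ w₂).trans ?_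
        refine Eq.trans ?_ ((dir_eval (𝟙 (triTotal (tri p q) r))).trans
          (congrArg (· ≫ r.map) (Category.id_comp _)))
        refine eval_congr (p := tri p q) (Category.id_comp _).symm ?_ _
        rw [Category.id_comp]
        apply dir_ext
        · rw [mkDir_hom]
          exact triHom_proj (tri p q) r
        · rw [mkDir_fst]
        · rw [mkDir_snd]))
    (mkDir_hom _ _ _ _ _).symm

/-- The inverse of the associator on directions, `(a, (d, s)) ↦ ((a, d), s)`. -/
noncomputable def assocDirInv : triTotal p (tri q r) ⟶ triTotal (tri p q) r :=
  have w₁ : (triHom p (tri q r) ≫ assocInvPQ p q r) ≫ triProj p q =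
      dirFst p (tri q r) ≫ p.map := by
    rw [Category.assoc, assocInvPQ_proj, triHom_proj]
  have w₂ : eval (q := tri q r) (triHom p (tri q r)) (dirFst p (tri q r)) (triHom_proj _ _) =
      dirSnd p (tri q r) ≫ triHom q r := by
    refine (eval_congr (q := tri q r) (Category.id_comp _).symm (Category.id_comp _).symm _).trans
      ((dir_eval (𝟙 (triTotal p (tri q r)))).trans
        (congrArg (· ≫ triHom q r) (Category.id_comp _)))
  have w₃ : eval (triHom p (tri q r) ≫ assocInvPQ p q r) (dirFst p (tri q r)) w₁ =
      (dirSnd p (tri q r) ≫ dirFst q r) ≫ q.map := by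
    rw [eval_assocInvPQ, w₂, dir_proj]
  mkDir (p := tri p q) (triHom p (tri q r) ≫ assocPosInv p q r)
    (mkDir (triHom p (tri q r) ≫ assocInvPQ p q r) (dirFst p (tri q r)) w₁
      (dirSnd p (tri q r) ≫ dirFst q r) w₃)
    (by rw [Category.assoc, assocPosInv_proj, mkDir_hom])
    (dirSnd p (tri q r) ≫ dirSnd q r)
    (by
      have w₄ : eval (q := tri q r) (triHom p (tri q r))
          (mkDir (triHom p (tri q r) ≫ assocInvPQ p q r) (dirFst p (tri q r)) w₁
            (dirSnd p (tri q r) ≫ dirFst q r) w₃ ≫ dirFst p q)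
          (by rw [mkDir_fst, triHom_proj]) = dirSnd p (tri q r) ≫ triHom q r :=
        (eval_congr (q := tri q r) rfl (mkDir_fst _ _ _ _ _) _).trans w₂
      refine (eval_assocPosInv _ _ _ (by rw [mkDir_fst, triHom_proj])
        (by rw [w₄, mkDir_snd, dir_proj])).trans ?_
      exact (eval_congr w₄ (mkDir_snd _ _ _ _ _) _).trans (dir_eval _))

theorem assocDir_hom : assocDir p q r ≫ triHom p (tri q r) =
    triHom (tri p q) r ≫ assocPos p q r := mkDir_hom _ _ _ _ _

theorem assocDirInv_hom : assocDirInv p q r ≫ triHom (tri p q) r =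
    triHom p (tri q r) ≫ assocPosInv p q r := mkDir_hom _ _ _ _ _

theorem assocDir_fst : assocDir p q r ≫ dirFst p (tri q r) = dirFst (tri p q) r ≫ dirFst p q :=
  mkDir_fst _ _ _ _ _

theorem assocDir_snd_fst : (assocDir p q r ≫ dirSnd p (tri q r)) ≫ dirFst q r =
    dirFst (tri p q) r ≫ dirSnd p q :=
  (congrArg (· ≫ dirFst q r) (mkDir_snd _ _ _ _ _)).trans (mkDir_fst _ _ _ _ _)

theorem assocDir_snd_snd : (assocDir p q r ≫ dirSnd p (tri q r)) ≫ dirSnd q r =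
    dirSnd (tri p q) r :=
  (congrArg (· ≫ dirSnd q r) (mkDir_snd _ _ _ _ _)).trans (mkDir_snd _ _ _ _ _)

theorem assocDirInv_fst_fst : (assocDirInv p q r ≫ dirFst (tri p q) r) ≫ dirFst p q =
    dirFst p (tri q r) :=
  (congrArg (· ≫ dirFst p q) (mkDir_fst (p := tri p q) _ _ _ _ _)).trans (mkDir_fst _ _ _ _ _)

theorem assocDirInv_fst_snd : (assocDirInv p q r ≫ dirFst (tri p q) r) ≫ dirSnd p q =
    dirSnd p (tri q r) ≫ dirFst q r :=
  (congrArg (· ≫ dirSnd p q) (mkDir_fst (p := tri p q) _ _ _ _ _)).trans (mkDir_snd _ _ _ _ _)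

theorem assocDirInv_snd : assocDirInv p q r ≫ dirSnd (tri p q) r =
    dirSnd p (tri q r) ≫ dirSnd q r :=
  mkDir_snd (p := tri p q) _ _ _ _ _

theorem assocDir_hom_inv_id : assocDir p q r ≫ assocDirInv p q r = 𝟙 _ := by
  have h : (assocDir p q r ≫ assocDirInv p q r) ≫ triHom (tri p q) r = triHom (tri p q) r := by
    rw [Category.assoc, assocDirInv_hom, ← Category.assoc, assocDir_hom, Category.assoc,
      assocPos_hom_inv_id, Category.comp_id]
  have k : dirFst (tri p q) r ≫ triHom p q = triHom (tri p q) r ≫ triProj (tri p q) r :=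
    (triHom_proj (tri p q) r).symm
  apply dir_ext (p := tri p q)
  · rw [h, Category.id_comp]
  · rw [Category.id_comp]
    apply dir_ext
    · rw [Category.assoc, k, ← Category.assoc, h]
    · have := assocDirInv_fst_fst p q r
      rw [Category.assoc] at this
      rw [Category.assoc, Category.assoc, this, assocDir_fst]
    · have := assocDirInv_fst_snd p q r
      rw [Category.assoc] at this
      rw [Category.assoc, Category.assoc, this, ← Category.assoc, assocDir_snd_fst]
  · rw [Category.assoc, assocDirInv_snd, ← Category.assoc, assocDir_snd_snd, Category.id_comp]

theorem assocDir_inv_hom_id : assocDirInv p q r ≫ assocDir p q r = 𝟙 _ := by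
  have h : (assocDirInv p q r ≫ assocDir p q r) ≫ triHom p (tri q r) = triHom p (tri q r) := by
    rw [Category.assoc, assocDir_hom, ← Category.assoc, assocDirInv_hom, Category.assoc,
      assocPos_inv_hom_id, Category.comp_id]
  have h₁ : (assocDirInv p q r ≫ assocDir p q r) ≫ dirFst p (tri q r) = dirFst p (tri q r) := by
    rw [Category.assoc, assocDir_fst, ← Category.assoc, assocDirInv_fst_fst]
  apply dir_ext (q := tri q r)
  · rw [h, Category.id_comp]
  · rw [h₁, Category.id_comp]
  · rw [Category.id_comp]
    apply dir_ext
    · have e₁ := dir_eval (q := tri q r) (assocDirInv p q r ≫ assocDir p q r)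
      have e₂ := dir_eval (q := tri q r) (𝟙 (triTotal p (tri q r)))
      rw [Category.id_comp (dirSnd p (tri q r))] at e₂
      exact e₁.symm.trans ((eval_congr (q := tri q r) (h.trans (Category.id_comp _).symm)
        (h₁.trans (Category.id_comp _).symm) _).trans e₂)
    · have := assocDir_snd_fst p q r
      rw [Category.assoc] at this
      rw [Category.assoc, Category.assoc, this, ← Category.assoc, assocDirInv_fst_snd]
    · have := assocDir_snd_snd p q r
      rw [Category.assoc] at this
      rw [Category.assoc, Category.assoc, this, assocDirInv_snd]

/-- The isomorphism between the directions of `(p ◁ q) ◁ r` and of `p ◁ (q ◁ r)`. -/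
noncomputable def assocDirIso : triTotal (tri p q) r ≅ triTotal p (tri q r) where
  hom := assocDir p q r
  inv := assocDirInv p q r
  hom_inv_id := assocDir_hom_inv_id p q r
  inv_hom_id := assocDir_inv_hom_id p q r

/-- The associator `(p ◁ q) ◁ r ≅ p ◁ (q ◁ r)`. -/
noncomputable def triAssoc : tri (tri p q) r ≅ tri p (tri q r) :=
  isoOfArrowIso (assocPosIso p q r) (assocDirIso p q r) (assocDir_hom p q r)

end Assoc

/-! ### The interchange -/

section Interchange

variable (p q r s : PolyCat E)

/-- The interchange on positions, `Π_p (Q × P_*) × Π_r (S × R_*) ⟶ Π_{p ⊗ r} ((Q × S) × (P_* × R_*))`: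
`((I, J), (K, L)) ↦ (I, K, J × L)`. -/
noncomputable def interchangePos :
    triBase p q ⨯ triBase r s ⟶ triBase (tensor p r) (tensor q s) :=
  have w := pullback.condition (f := prod.map (triProj p q) (triProj r s))
    (g := prod.map p.map r.map)
  mkPos (p := tensor p r) (q := tensor q s) (prod.map (triProj p q) (triProj r s))
    (prod.lift
      (eval
        (pullback.fst (prod.map (triProj p q) (triProj r s)) (prod.map p.map r.map) ≫ prod.fst)
        (pullback.snd (prod.map (triProj p q) (triProj r s)) (prod.map p.map r.map) ≫ prod.fst)
        (by simpa using w =≫ prod.fst))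
      (eval
        (pullback.fst (prod.map (triProj p q) (triProj r s)) (prod.map p.map r.map) ≫ prod.snd)
        (pullback.snd (prod.map (triProj p q) (triProj r s)) (prod.map p.map r.map) ≫ prod.snd)
        (by simpa using w =≫ prod.snd)))

variable {p q r s}

theorem interchangePos_proj : interchangePos p q r s ≫ triProj (tensor p r) (tensor q s) =
    prod.map (triProj p q) (triProj r s) := mkPos_proj _ _

theorem eval_interchangePos {Y : E} (c : Y ⟶ triBase p q ⨯ triBase r s)
    (a : Y ⟶ p.total ⨯ r.total)
    (h : (c ≫ interchangePos p q r s) ≫ triProj (tensor p r) (tensor q s) =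
      a ≫ prod.map p.map r.map)
    (h₁ : (c ≫ prod.fst) ≫ triProj p q = (a ≫ prod.fst) ≫ p.map)
    (h₂ : (c ≫ prod.snd) ≫ triProj r s = (a ≫ prod.snd) ≫ r.map) :
    eval (p := tensor p r) (q := tensor q s) (c ≫ interchangePos p q r s) a h =
      prod.lift (eval (c ≫ prod.fst) (a ≫ prod.fst) h₁)
        (eval (c ≫ prod.snd) (a ≫ prod.snd) h₂) := by
  refine (eval_mkPos (p := tensor p r) (q := tensor q s) _ _ _ _ _).trans ?_
  apply Limits.prod.hom_ext
  · rw [Category.assoc, prod.lift_fst, prod.lift_fst]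
    exact (comp_eval _ _ _ _).trans (eval_congr (pullback.lift_fst_assoc _ _ _ _)
      (pullback.lift_snd_assoc _ _ _ _) _)
  · rw [Category.assoc, prod.lift_snd, prod.lift_snd]
    exact (comp_eval _ _ _ _).trans (eval_congr (pullback.lift_fst_assoc _ _ _ _)
      (pullback.lift_snd_assoc _ _ _ _) _)

variable (p q r s)

/-- The interchange `(p ◁ q) ⊗ (r ◁ s) ⟶ (p ⊗ r) ◁ (q ⊗ s)`: `interchangePos` on positions, and the
isomorphism `((a, a'), (d, d')) ↦ ((a, d), (a', d'))` on directions. -/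
noncomputable def interchange :
    tensor (tri p q) (tri r s) ⟶ tri (tensor p r) (tensor q s) where
  pos := interchangePos p q r s
  dir :=
    have w := pullback.condition (f := interchangePos p q r s)
      (g := triHom (tensor p r) (tensor q s))
    have k : (pullback.fst (interchangePos p q r s) (triHom (tensor p r) (tensor q s)) ≫
        interchangePos p q r s) ≫ triProj (tensor p r) (tensor q s) =
        (pullback.snd (interchangePos p q r s) (triHom (tensor p r) (tensor q s)) ≫
          dirFst (tensor p r) (tensor q s)) ≫ prod.map p.map r.map := by
      rw [w, dir_proj]
    have k₁ : (pullback.fst (interchangePos p q r s) (triHom (tensor p r) (tensor q s)) ≫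
        prod.fst) ≫ triProj p q =
        ((pullback.snd (interchangePos p q r s) (triHom (tensor p r) (tensor q s)) ≫
          dirFst (tensor p r) (tensor q s)) ≫ prod.fst) ≫ p.map := by
      have := k =≫ prod.fst
      rw [Category.assoc _ _ (triProj (tensor p r) (tensor q s)), interchangePos_proj] at this
      simpa using this
    have k₂ : (pullback.fst (interchangePos p q r s) (triHom (tensor p r) (tensor q s)) ≫
        prod.snd) ≫ triProj r s =
        ((pullback.snd (interchangePos p q r s) (triHom (tensor p r) (tensor q s)) ≫
          dirFst (tensor p r) (tensor q s)) ≫ prod.snd) ≫ r.map := by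
      have := k =≫ prod.snd
      rw [Category.assoc _ _ (triProj (tensor p r) (tensor q s)), interchangePos_proj] at this
      simpa using this
    have e := (eval_interchangePos _ _ k k₁ k₂).symm.trans
      ((eval_congr (p := tensor p r) (q := tensor q s) w rfl _).trans (dir_eval _))
    prod.lift
      (mkDir
        (pullback.fst (interchangePos p q r s) (triHom (tensor p r) (tensor q s)) ≫ prod.fst)
        ((pullback.snd (interchangePos p q r s) (triHom (tensor p r) (tensor q s)) ≫
          dirFst (tensor p r) (tensor q s)) ≫ prod.fst) k₁
        ((pullback.snd (interchangePos p q r s) (triHom (tensor p r) (tensor q s)) ≫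
          dirSnd (tensor p r) (tensor q s)) ≫ prod.fst)
        (by simpa [prod.lift_fst] using e =≫ prod.fst))
      (mkDir
        (pullback.fst (interchangePos p q r s) (triHom (tensor p r) (tensor q s)) ≫ prod.snd)
        ((pullback.snd (interchangePos p q r s) (triHom (tensor p r) (tensor q s)) ≫
          dirFst (tensor p r) (tensor q s)) ≫ prod.snd) k₂
        ((pullback.snd (interchangePos p q r s) (triHom (tensor p r) (tensor q s)) ≫
          dirSnd (tensor p r) (tensor q s)) ≫ prod.snd)
        (by simpa [prod.lift_snd] using e =≫ prod.snd))
  dir_map := by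
    refine (prod.lift_map _ _ _ _).trans ?_
    rw [mkDir_hom, mkDir_hom]
    apply Limits.prod.hom_ext
    · rw [prod.lift_fst]
    · rw [prod.lift_snd]

end Interchange

variable (E)

/-- The data of the monoidal category `(Poly_E, y, ⊗)`. -/
noncomputable abbrev tensorStruct : MonoidalCategoryStruct (PolyCat E) where
  tensorObj := tensor
  tensorUnit := y
  tensorHom := tensorMap
  whiskerLeft p _ _ φ := tensorMap (𝟙 p) φ
  whiskerRight φ q := tensorMap φ (𝟙 q)
  associator := tensorAssoc
  leftUnitor := tensorLeftUnitor
  rightUnitor := tensorRightUnitor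

/-- The data of the monoidal category `(Poly_E, y, ◁)`. -/
noncomputable abbrev triStruct : MonoidalCategoryStruct (PolyCat E) where
  tensorObj := tri
  tensorUnit := y
  tensorHom := triMap
  whiskerLeft p _ _ φ := triMap (𝟙 p) φ
  whiskerRight φ q := triMap φ (𝟙 q)
  associator := triAssoc
  leftUnitor := triLeftUnitor
  rightUnitor := triRightUnitor

/-- The data of the duoidal category `(Poly_E, y, ⊗, y, ◁)`. -/
noncomputable abbrev duoidalStruct : DuoidalStruct (PolyCat E) where
  M := tensorStruct E
  N := triStruct E
  interchange := interchange
  comult := (triLeftUnitor y).inv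
  mult := (tensorLeftUnitor y).hom
  unit := 𝟙 y

end Monoidal

end PolyCat

namespace PolyCat

/-! ### Morphisms of polynomials on generalized elements -/

section

variable {E : Type u} [Category.{v} E] [HasPullbacks E]

/-! The proof computes with generalized elements, as if `E` were the category of sets. A morphism
`φ` of polynomials is determined by its effect `b ≫ φ.pos` on positions `b : Y ⟶ P` and by the
directions `φ.app b d` (`Hom.ext_elements`). A position `c` of `p ◁ q` is a position `c ≫ triProj p
q` of `p` together with a function `a ↦ eval c a` from the directions of `p` there to positions of
`q`; by the adjunction `Δ_p ⊣ Π_p` it is determined by these data, provided that `eval` is tested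
after every change of stage `x : Z ⟶ Y` (`pos_ext`). A direction of `p ◁ q` is a compatible triple
`mkDir c a d` (`dir_ext`).

Each structure morphism then has an explicit formula: `tensorMap_app`, `tensorAssoc_hom_app` for
`⊗`; `eval_comp_triMap_pos`, `triMap_app_eq` for the action of `◁`;
`eval_eval_comp_triAssoc_hom_pos`, `triAssoc_hom_app` for its associator, which is currying;
`eval_comp_interchange_pos`, `interchange_app` for the interchange, which evaluates componentwise
and reshuffles `((a, a'), (d, d'))` to `((a, d), (a', d'))`. The unitors either evaluate at the only
direction of `y` or forget a function into the terminal object.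

With these formulas as rewriting rules, the two sides of every coherence diagram reduce to the same
term. The compatibility conditions carried by `app`, `eval` and `mkDir` are proofs, so only the
underlying elements have to agree. The few axioms that involve units alone hold because everything
in sight is terminal. -/

theorem Hom.app_congr {p q : PolyCat E} {φ : Hom p q} {Y : E} {b b' : Y ⟶ p.base}
    {d d' : Y ⟶ q.total} (hb : b = b') (hd : d = d') (h : b ≫ φ.pos = d ≫ q.map) :
    φ.app b d h = φ.app b' d' (by rw [← hb, h, hd]) := by
  subst hb hd
  rfl

/-- Brackets to the left, so that `b ≫ Hom.pos φ` is again an element to which the formula for `ψ`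
applies. All formulas below are stated in this shape. -/
theorem comp_comp_pos {p q r : PolyCat E} (φ : p ⟶ q) (ψ : q ⟶ r) {Y : E} (b : Y ⟶ p.base) :
    b ≫ Hom.pos (φ ≫ ψ) = (b ≫ Hom.pos φ) ≫ Hom.pos ψ := by
  rw [comp_pos, Category.assoc]

/-- Variant of `Hom.ext_app` that also tests positions on elements, the form in which the formulas
for structure morphisms are stated. The universal element `𝟙` gives back the equality of the
morphisms on positions. -/
theorem Hom.ext_elements {p q : PolyCat E} {φ ψ : p ⟶ q}
    (h : ∀ ⦃Y : E⦄ (b : Y ⟶ p.base), b ≫ Hom.pos φ = b ≫ Hom.pos ψ)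
    (h' : ∀ ⦃Y : E⦄ (b : Y ⟶ p.base) (d : Y ⟶ q.total) (hφ : b ≫ Hom.pos φ = d ≫ q.map)
      (hψ : b ≫ Hom.pos ψ = d ≫ q.map), Hom.app φ b d hφ = Hom.app ψ b d hψ) : φ = ψ :=
  Hom.ext_app (by simpa using h (𝟙 _)) h'

/-- Directions travel backwards, so the forward morphism acts on them through the inverse of the
isomorphism of total objects. -/
theorem isoOfArrowIso_hom_app {p q : PolyCat E} (e : p.base ≅ q.base) (e' : p.total ≅ q.total)
    (w : e'.hom ≫ q.map = p.map ≫ e.hom) {Y : E} (b : Y ⟶ p.base) (d : Y ⟶ q.total)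
    (h : b ≫ Hom.pos (isoOfArrowIso e e' w).hom = d ≫ q.map) :
    Hom.app (isoOfArrowIso e e' w).hom b d h = d ≫ e'.inv :=
  pullback.lift_snd_assoc _ _ _ _

end

/-! ### Products and the tensor product on generalized elements -/

section

variable {E : Type u} [Category.{v} E] [HasFiniteLimits E]

theorem comp_prodLift {X Y A B : E} (x : Y ⟶ X) (f : X ⟶ A) (g : X ⟶ B) :
    x ≫ prod.lift f g = prod.lift (x ≫ f) (x ≫ g) := prod.comp_lift _ _ _

/-- This and the neighbouring lemmas bring every element of a product to the normal form of a tuple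
of left-bracketed components. -/
theorem comp_prodMap {Y A B A' B' : E} (x : Y ⟶ A ⨯ B) (f : A ⟶ A') (g : B ⟶ B') :
    x ≫ prod.map f g = prod.lift ((x ≫ prod.fst) ≫ f) ((x ≫ prod.snd) ≫ g) := by
  apply Limits.prod.hom_ext <;> simp [prod.lift_fst, prod.lift_snd]

theorem prodLift_eta {Y A B : E} (x : Y ⟶ A ⨯ B) :
    prod.lift (x ≫ prod.fst) (x ≫ prod.snd) = x := by
  apply Limits.prod.hom_ext <;> simp [prod.lift_fst, prod.lift_snd]

theorem comp_prodAssociator_hom {Y A B C : E} (x : Y ⟶ (A ⨯ B) ⨯ C) :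
    x ≫ (prod.associator A B C).hom = prod.lift ((x ≫ prod.fst) ≫ prod.fst)
      (prod.lift ((x ≫ prod.fst) ≫ prod.snd) (x ≫ prod.snd)) := by
  simp [prod.comp_lift]

theorem comp_prodAssociator_inv {Y A B C : E} (x : Y ⟶ A ⨯ B ⨯ C) :
    x ≫ (prod.associator A B C).inv = prod.lift
      (prod.lift (x ≫ prod.fst) ((x ≫ prod.snd) ≫ prod.fst)) ((x ≫ prod.snd) ≫ prod.snd) := by
  simp [prod.comp_lift]

variable {p p' q q' r r' s : PolyCat E} {Y : E}

theorem tensorMap_pos (φ : p ⟶ p') (ψ : q ⟶ q') :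
    Hom.pos (tensorMap φ ψ) = prod.map (Hom.pos φ) (Hom.pos ψ) := rfl

theorem tensorMap_app (φ : p ⟶ p') (ψ : q ⟶ q') (b : Y ⟶ p.base ⨯ q.base)
    (d : Y ⟶ p'.total ⨯ q'.total)
    (h : b ≫ Hom.pos (tensorMap φ ψ) = d ≫ prod.map p'.map q'.map) :
    Hom.app (tensorMap φ ψ) b d h = prod.lift
      (Hom.app φ (b ≫ prod.fst) (d ≫ prod.fst)
        (by simpa [tensorMap_pos] using h =≫ prod.fst))
      (Hom.app ψ (b ≫ prod.snd) (d ≫ prod.snd)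
        (by simpa [tensorMap_pos] using h =≫ prod.snd)) := by
  -- By definition `app` is precomposition of `dir` with `pullback.lift b d h`, and `dir` is a pair
  -- of values of `app` at the universal element of the pullback; the precomposition moves into each
  -- of them.
  refine (comp_prodLift _ _ _).trans (congrArg₂ prod.lift ?_ ?_) <;>
  exact (Hom.comp_app _ _ _ _ _).trans (Hom.app_congr (pullback.lift_fst_assoc _ _ _ _)
    (pullback.lift_snd_assoc _ _ _ _) _)

theorem tensorAssoc_hom_pos :
    Hom.pos (tensorAssoc p q r).hom = (prod.associator p.base q.base r.base).hom := rfl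

theorem tensorAssoc_hom_app (b : Y ⟶ (p.base ⨯ q.base) ⨯ r.base)
    (d : Y ⟶ p.total ⨯ q.total ⨯ r.total)
    (h : b ≫ Hom.pos (tensorAssoc p q r).hom = d ≫ prod.map p.map (prod.map q.map r.map)) :
    Hom.app (tensorAssoc p q r).hom b d h = prod.lift
      (prod.lift (d ≫ prod.fst) ((d ≫ prod.snd) ≫ prod.fst)) ((d ≫ prod.snd) ≫ prod.snd) :=
  (isoOfArrowIso_hom_app _ _ _ _ _ _).trans (comp_prodAssociator_inv d)

theorem tensorLeftUnitor_hom_pos : Hom.pos (tensorLeftUnitor p).hom = prod.snd := rfl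

theorem tensorLeftUnitor_hom_app (b : Y ⟶ (⊤_ E) ⨯ p.base) (d : Y ⟶ p.total)
    (h : b ≫ Hom.pos (tensorLeftUnitor p).hom = d ≫ p.map) :
    Hom.app (tensorLeftUnitor p).hom b d h = prod.lift (terminal.from _) d :=
  (isoOfArrowIso_hom_app _ _ _ _ _ _).trans (by
    change d ≫ prod.lift _ _ = _
    rw [comp_prodLift, Category.comp_id]
    congr 1
    exact terminal.hom_ext _ _)

theorem tensorRightUnitor_hom_pos : Hom.pos (tensorRightUnitor p).hom = prod.fst := rfl

theorem tensorRightUnitor_hom_app (b : Y ⟶ p.base ⨯ (⊤_ E)) (d : Y ⟶ p.total)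
    (h : b ≫ Hom.pos (tensorRightUnitor p).hom = d ≫ p.map) :
    Hom.app (tensorRightUnitor p).hom b d h = prod.lift d (terminal.from _) :=
  (isoOfArrowIso_hom_app _ _ _ _ _ _).trans (by
    change d ≫ prod.lift _ _ = _
    rw [comp_prodLift, Category.comp_id]
    congr 1
    exact terminal.hom_ext _ _)

/-! ### The composition product on generalized elements -/

theorem mkDir_eta (e : Y ⟶ triTotal p q) :
    mkDir (e ≫ triHom p q) (e ≫ dirFst p q) (dir_proj e) (e ≫ dirSnd p q) (dir_eval e) = e := by
  apply dir_ext <;> simp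

/-- The form of eta that occurs when a direction has been taken apart and reassembled over a
position known only propositionally to be the one below it. -/
theorem mkDir_eta_of_eq (c : Y ⟶ triBase p q) (e : Y ⟶ triTotal p q) (h : c = e ≫ triHom p q) :
    mkDir c (e ≫ dirFst p q) (by rw [h, dir_proj]) (e ≫ dirSnd p q) (by subst h; exact dir_eval e) =
      e := by
  subst h
  exact mkDir_eta e

theorem comp_mkDir {Z : E} (y : Z ⟶ Y) (c : Y ⟶ triBase p q) (a : Y ⟶ p.total)
    (h : c ≫ triProj p q = a ≫ p.map) (d : Y ⟶ q.total) (h' : eval c a h = d ≫ q.map) :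
    y ≫ mkDir c a h d h' = mkDir (y ≫ c) (y ≫ a) (by simp only [Category.assoc, h]) (y ≫ d)
      (by rw [← comp_eval _ _ _ h, h', Category.assoc]) := by
  apply dir_ext
  · rw [Category.assoc, mkDir_hom, mkDir_hom]
  · rw [Category.assoc, mkDir_fst, mkDir_fst]
  · rw [Category.assoc, mkDir_snd, mkDir_snd]

theorem comp_triMap_pos_proj (φ : p ⟶ p') (ψ : q ⟶ q') (c : Y ⟶ triBase p q) :
    (c ≫ Hom.pos (triMap φ ψ)) ≫ triProj p' q' = (c ≫ triProj p q) ≫ Hom.pos φ := by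
  rw [Category.assoc, Category.assoc]
  exact congrArg (c ≫ ·) (triMapPos_proj φ ψ)

theorem eval_comp_triMap_pos (φ : p ⟶ p') (ψ : q ⟶ q') (c : Y ⟶ triBase p q) (a : Y ⟶ p'.total)
    (h : (c ≫ Hom.pos (triMap φ ψ)) ≫ triProj p' q' = a ≫ p'.map) :
    eval (c ≫ Hom.pos (triMap φ ψ)) a h =
      eval c (Hom.app φ (c ≫ triProj p q) a (by rw [← comp_triMap_pos_proj, h]))
        (by rw [Hom.app_map]) ≫ Hom.pos ψ := eval_triMapPos φ ψ c a h

theorem triMap_app_eq (φ : p ⟶ p') (ψ : q ⟶ q') (c : Y ⟶ triBase p q) (e : Y ⟶ triTotal p' q')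
    (h : c ≫ Hom.pos (triMap φ ψ) = e ≫ triHom p' q') :
    Hom.app (triMap φ ψ) c e h = mkDir c
      (Hom.app φ (c ≫ triProj p q) (e ≫ dirFst p' q')
        (by rw [← comp_triMap_pos_proj, h, dir_proj]))
      (by rw [Hom.app_map])
      (Hom.app ψ
        (eval c (Hom.app φ (c ≫ triProj p q) (e ≫ dirFst p' q')
          (by rw [← comp_triMap_pos_proj, h, dir_proj])) (by rw [Hom.app_map]))
        (e ≫ dirSnd p' q')
        (by
          rw [← dir_eval]
          exact (eval_comp_triMap_pos φ ψ _ _ (by rw [h, dir_proj])).symm.trans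
            (eval_congr h rfl _)))
      (Hom.app_map _ _ _ _).symm := by
  -- The direction part of `triMap` is a `mkDir` over the universal element of a pullback.
  -- Precomposing with `pullback.lift c e h` specializes it, and `h₀`, `h₁` identify the two
  -- coordinates.
  refine (comp_mkDir _ _ _ _ _ _).trans ?_
  have h₀ : pullback.lift c e h ≫ pullback.fst _ _ = c := pullback.lift_fst _ _ _
  have h₁ : pullback.lift c e h ≫ pullback.snd _ _ = e := pullback.lift_snd _ _ _
  apply dir_ext
  · rw [mkDir_hom, mkDir_hom]; exact h₀
  · rw [mkDir_fst, mkDir_fst]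
    exact (Hom.comp_app _ _ _ _ _).trans (Hom.app_congr ((Category.assoc _ _ _).symm.trans
      (congrArg (· ≫ _) h₀)) ((Category.assoc _ _ _).symm.trans (congrArg (· ≫ _) h₁)) _)
  · rw [mkDir_snd, mkDir_snd]
    refine (Hom.comp_app _ _ _ _ _).trans (Hom.app_congr ((comp_eval _ _ _ _).trans
      (eval_congr h₀ ?_ _)) ((Category.assoc _ _ _).symm.trans (congrArg (· ≫ _) h₁)) _)
    exact (Hom.comp_app _ _ _ _ _).trans (Hom.app_congr ((Category.assoc _ _ _).symm.trans
      (congrArg (· ≫ _) h₀)) ((Category.assoc _ _ _).symm.trans (congrArg (· ≫ _) h₁)) _)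

theorem comp_triAssoc_hom_pos_proj (c : Y ⟶ triBase (tri p q) r) :
    (c ≫ Hom.pos (triAssoc p q r).hom) ≫ triProj p (tri q r) =
      (c ≫ triProj (tri p q) r) ≫ triProj p q := by
  rw [Category.assoc, Category.assoc]
  exact congrArg (c ≫ ·) assocPos_proj

theorem eval_comp_triAssoc_hom_pos_proj (c : Y ⟶ triBase (tri p q) r) (a : Y ⟶ p.total)
    (h : (c ≫ Hom.pos (triAssoc p q r).hom) ≫ triProj p (tri q r) = a ≫ p.map) :
    eval (q := tri q r) (c ≫ Hom.pos (triAssoc p q r).hom) a h ≫ triProj q r =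
      eval (c ≫ triProj (tri p q) r) a (by rw [← h, comp_triAssoc_hom_pos_proj]) :=
  eval_assocPos_proj c a h

/-- The associator is currying: evaluating its value at `a` and then at `d` is evaluating the
original function at the pair `(a, d)`. -/
theorem eval_eval_comp_triAssoc_hom_pos (c : Y ⟶ triBase (tri p q) r) (a : Y ⟶ p.total)
    (h : (c ≫ Hom.pos (triAssoc p q r).hom) ≫ triProj p (tri q r) = a ≫ p.map) (d : Y ⟶ q.total)
    (h' : eval (q := tri q r) (c ≫ Hom.pos (triAssoc p q r).hom) a h ≫ triProj q r =
      d ≫ q.map) :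
    eval (eval (q := tri q r) (c ≫ Hom.pos (triAssoc p q r).hom) a h) d h' =
      eval (p := tri p q) c
        (mkDir (c ≫ triProj (tri p q) r) a
          (by rw [← h, comp_triAssoc_hom_pos_proj]) d
          ((eval_comp_triAssoc_hom_pos_proj c a h).symm.trans h'))
        (mkDir_hom _ _ _ _ _).symm :=
  eval_eval_assocPos c a h d h'

theorem triAssoc_hom_app_hom (c : Y ⟶ triBase (tri p q) r) (e : Y ⟶ triTotal p (tri q r))
    (h : c ≫ Hom.pos (triAssoc p q r).hom = e ≫ triHom p (tri q r)) :
    Hom.app (triAssoc p q r).hom c e h ≫ triHom (tri p q) r = c :=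
  Hom.app_map _ _ _ _

theorem triAssoc_hom_app_fst_fst (c : Y ⟶ triBase (tri p q) r) (e : Y ⟶ triTotal p (tri q r))
    (h : c ≫ Hom.pos (triAssoc p q r).hom = e ≫ triHom p (tri q r)) :
    (Hom.app (triAssoc p q r).hom c e h ≫ dirFst (tri p q) r) ≫ dirFst p q =
      e ≫ dirFst p (tri q r) := by
  have := assocDirInv_fst_fst p q r
  rw [Category.assoc] at this
  rw [← this, ← Category.assoc, ← Category.assoc]
  exact congrArg (fun k => (k ≫ dirFst (tri p q) r) ≫ dirFst p q) (isoOfArrowIso_hom_app _ _ _ _ _ _)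

theorem triAssoc_hom_app_fst_snd (c : Y ⟶ triBase (tri p q) r) (e : Y ⟶ triTotal p (tri q r))
    (h : c ≫ Hom.pos (triAssoc p q r).hom = e ≫ triHom p (tri q r)) :
    (Hom.app (triAssoc p q r).hom c e h ≫ dirFst (tri p q) r) ≫ dirSnd p q =
      (e ≫ dirSnd p (tri q r)) ≫ dirFst q r := by
  have := assocDirInv_fst_snd p q r
  rw [Category.assoc] at this
  rw [Category.assoc e, ← this, ← Category.assoc, ← Category.assoc]
  exact congrArg (fun k => (k ≫ dirFst (tri p q) r) ≫ dirSnd p q) (isoOfArrowIso_hom_app _ _ _ _ _ _)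

theorem triAssoc_hom_app_snd (c : Y ⟶ triBase (tri p q) r) (e : Y ⟶ triTotal p (tri q r))
    (h : c ≫ Hom.pos (triAssoc p q r).hom = e ≫ triHom p (tri q r)) :
    Hom.app (triAssoc p q r).hom c e h ≫ dirSnd (tri p q) r =
      (e ≫ dirSnd p (tri q r)) ≫ dirSnd q r := by
  rw [Category.assoc, ← assocDirInv_snd, ← Category.assoc]
  exact congrArg (fun k => k ≫ dirSnd (tri p q) r) (isoOfArrowIso_hom_app _ _ _ _ _ _)

/-- The direction of `p ◁ q` below the value of the associator on directions. -/
theorem triAssoc_hom_app_fst_hom (c : Y ⟶ triBase (tri p q) r) (e : Y ⟶ triTotal p (tri q r))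
    (h : c ≫ Hom.pos (triAssoc p q r).hom = e ≫ triHom p (tri q r)) :
    (Hom.app (triAssoc p q r).hom c e h ≫ dirFst (tri p q) r) ≫ triHom p q =
      c ≫ triProj (tri p q) r := by
  rw [← dir_proj (p := tri p q), triAssoc_hom_app_hom]

theorem comp_triLeftUnitor_hom_pos (c : Y ⟶ triBase y p) (a : Y ⟶ ⊤_ E)
    (h : c ≫ triProj y p = a ≫ 𝟙 _) :
    c ≫ Hom.pos (triLeftUnitor p).hom = eval (p := y) (q := p) c a h :=
  comp_triLeftBase p c a h

theorem triLeftUnitor_hom_app_snd (c : Y ⟶ triBase y p) (d : Y ⟶ p.total)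
    (h : c ≫ Hom.pos (triLeftUnitor p).hom = d ≫ p.map) :
    Hom.app (triLeftUnitor p).hom c d h ≫ dirSnd y p = d := by
  refine (congrArg (fun k => k ≫ dirSnd y p) (isoOfArrowIso_hom_app _ _ _ _ _ _)).trans ?_
  exact (Category.assoc _ _ _).trans ((congrArg (d ≫ ·) (triLeftTotalIso p).inv_hom_id).trans
    (Category.comp_id _))

theorem comp_triRightUnitor_hom_pos (c : Y ⟶ triBase p y) :
    c ≫ Hom.pos (triRightUnitor p).hom = c ≫ triProj p y := rfl

theorem triRightUnitor_hom_app_fst (c : Y ⟶ triBase p y) (d : Y ⟶ p.total)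
    (h : c ≫ Hom.pos (triRightUnitor p).hom = d ≫ p.map) :
    Hom.app (triRightUnitor p).hom c d h ≫ dirFst p y = d := by
  refine (congrArg (fun k => k ≫ dirFst p y) (isoOfArrowIso_hom_app _ _ _ _ _ _)).trans ?_
  exact (Category.assoc _ _ _).trans ((congrArg (d ≫ ·) (triRightTotalIso p).inv_hom_id).trans
    (Category.comp_id _))

theorem comp_interchange_pos_proj (c : Y ⟶ triBase p q ⨯ triBase r s) :
    (c ≫ Hom.pos (interchange p q r s)) ≫ triProj (tensor p r) (tensor q s) =
      prod.lift ((c ≫ prod.fst) ≫ triProj p q) ((c ≫ prod.snd) ≫ triProj r s) := by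
  rw [← comp_prodMap, Category.assoc]
  exact congrArg (c ≫ ·) interchangePos_proj

theorem eval_comp_interchange_pos (c : Y ⟶ triBase p q ⨯ triBase r s)
    (a : Y ⟶ p.total ⨯ r.total)
    (h : (c ≫ Hom.pos (interchange p q r s)) ≫ triProj (tensor p r) (tensor q s) =
      a ≫ prod.map p.map r.map) :
    eval (p := tensor p r) (q := tensor q s) (c ≫ Hom.pos (interchange p q r s)) a h =
      prod.lift
        (eval (c ≫ prod.fst) (a ≫ prod.fst)
          (by
            simpa [prod.lift_fst] using
              ((comp_interchange_pos_proj c).symm.trans h) =≫ prod.fst))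
        (eval (c ≫ prod.snd) (a ≫ prod.snd)
          (by
            simpa [prod.lift_snd] using
              ((comp_interchange_pos_proj c).symm.trans h) =≫ prod.snd)) :=
  eval_interchangePos c a h _ _


theorem mkDir_congr {c c' : Y ⟶ triBase p q} {a a' : Y ⟶ p.total} {d d' : Y ⟶ q.total}
    (hc : c = c') (ha : a = a') (hd : d = d') (h : c ≫ triProj p q = a ≫ p.map)
    (h' : eval c a h = d ≫ q.map) :
    mkDir c a h d h' = mkDir c' a' (by rw [← hc, ← ha, h]) d'
      ((eval_congr hc.symm ha.symm _).trans (h'.trans (congrArg (· ≫ q.map) hd))) := by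
  subst hc ha hd
  rfl

/-! ### The associator on directions as a single triple -/

section

variable (c : Y ⟶ triBase (tri p q) r) (e : Y ⟶ triTotal p (tri q r))

theorem triAssoc_dir_proj
    (h : c ≫ Hom.pos (triAssoc p q r).hom = e ≫ triHom p (tri q r)) :
    (c ≫ triProj (tri p q) r) ≫ triProj p q = (e ≫ dirFst p (tri q r)) ≫ p.map := by
  rw [← comp_triAssoc_hom_pos_proj, h, dir_proj]

/-- For `e = (a, (d, s))`, the reassociated position evaluated at `a` is the position below `(d,
s)`. The compatibility conditions needed to write down `((a, d), s)` follow from this. -/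
theorem eval_comp_triAssoc_dirFst
    (h : c ≫ Hom.pos (triAssoc p q r).hom = e ≫ triHom p (tri q r)) :
    eval (q := tri q r) (c ≫ Hom.pos (triAssoc p q r).hom) (e ≫ dirFst p (tri q r))
      (by rw [h, dir_proj]) = (e ≫ dirSnd p (tri q r)) ≫ triHom q r :=
  (eval_congr (q := tri q r) h rfl _).trans (dir_eval (q := tri q r) e)

theorem triAssoc_dir_eval
    (h : c ≫ Hom.pos (triAssoc p q r).hom = e ≫ triHom p (tri q r)) :
    eval (c ≫ triProj (tri p q) r) (e ≫ dirFst p (tri q r)) (triAssoc_dir_proj c e h) =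
      ((e ≫ dirSnd p (tri q r)) ≫ dirFst q r) ≫ q.map := by
  rw [← eval_comp_triAssoc_hom_pos_proj c _ (by rw [h, dir_proj])]
  exact (congrArg (· ≫ triProj q r) (eval_comp_triAssoc_dirFst c e h)).trans (dir_proj _)

theorem triAssoc_dir_eval_mkDir
    (h : c ≫ Hom.pos (triAssoc p q r).hom = e ≫ triHom p (tri q r)) :
    eval (p := tri p q) c (mkDir (c ≫ triProj (tri p q) r) (e ≫ dirFst p (tri q r))
      (triAssoc_dir_proj c e h) ((e ≫ dirSnd p (tri q r)) ≫ dirFst q r)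
      (triAssoc_dir_eval c e h)) (mkDir_hom _ _ _ _ _).symm =
      ((e ≫ dirSnd p (tri q r)) ≫ dirSnd q r) ≫ r.map := by
  have k := eval_comp_triAssoc_dirFst c e h
  -- Uncurrying read backwards: evaluation at `(a, d)` becomes evaluation at `a` and then at `d`,
  -- and there `s` is compatible because `(d, s)` is a direction of `q ◁ r`.
  refine (eval_eval_comp_triAssoc_hom_pos c _ (by rw [h, dir_proj]) _ ?_).symm.trans
    ((eval_congr k rfl _).trans (dir_eval _))
  exact (congrArg (· ≫ triProj q r) k).trans (dir_proj _)

/-- Collects the componentwise formulas into one `mkDir`, so that both sides of a diagram involving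
the associator become explicit triples. -/
theorem triAssoc_hom_app
    (h : c ≫ Hom.pos (triAssoc p q r).hom = e ≫ triHom p (tri q r)) :
    Hom.app (triAssoc p q r).hom c e h =
      mkDir (p := tri p q) c (mkDir (c ≫ triProj (tri p q) r) (e ≫ dirFst p (tri q r))
        (triAssoc_dir_proj c e h) ((e ≫ dirSnd p (tri q r)) ≫ dirFst q r)
        (triAssoc_dir_eval c e h)) (mkDir_hom _ _ _ _ _).symm
        ((e ≫ dirSnd p (tri q r)) ≫ dirSnd q r) (triAssoc_dir_eval_mkDir c e h) := by
  refine dir_ext (p := tri p q) ?_ ?_ ?_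
  · rw [triAssoc_hom_app_hom, mkDir_hom]
  · rw [mkDir_fst]
    apply dir_ext
    · rw [triAssoc_hom_app_fst_hom, mkDir_hom]
    · rw [triAssoc_hom_app_fst_fst, mkDir_fst]
    · rw [triAssoc_hom_app_fst_snd, mkDir_snd]
  · rw [triAssoc_hom_app_snd, mkDir_snd]

end

/-! ### Elements of the unit polynomial -/

/-- In these lemmas `terminal.from Y` is the normal form of every element of the terminal object, so
that terms containing such elements agree literally. -/
theorem app_unit {φ : y ⟶ p} (b : Y ⟶ ⊤_ E) (d : Y ⟶ p.total) (h : b ≫ Hom.pos φ = d ≫ p.map) :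
    Hom.app φ b d h = terminal.from Y := terminal.hom_ext _ _

theorem comp_dirFst_unit (e : Y ⟶ triTotal y p) : e ≫ dirFst y p = terminal.from Y :=
  terminal.hom_ext _ _

theorem comp_dirSnd_unit (e : Y ⟶ triTotal p y) : e ≫ dirSnd p y = terminal.from Y :=
  terminal.hom_ext _ _

theorem comp_triProj_unit (c : Y ⟶ triBase y p) : c ≫ triProj y p = terminal.from Y :=
  terminal.hom_ext _ _

theorem eval_unit (c : Y ⟶ triBase p y) (a : Y ⟶ p.total) (h : c ≫ triProj p y = a ≫ p.map) :
    eval (q := y) c a h = terminal.from Y := terminal.hom_ext _ _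

/-- Evaluation at the only direction of `y` is the isomorphism `Π_1 (P × 1) ≅ P`, hence a
monomorphism; no change of stage is needed here. -/
theorem pos_unit_ext {c c' : Y ⟶ triBase y p}
    (h : eval (p := y) (q := p) c (terminal.from Y) (terminal.hom_ext _ _) =
      eval (p := y) (q := p) c' (terminal.from Y) (terminal.hom_ext _ _)) : c = c' := by
  rw [← cancel_mono (triLeftBaseIso p).hom]
  exact (comp_triLeftBase p c _ _).trans (h.trans (comp_triLeftBase p c' _ _).symm)

theorem triBase_unit_ext {c c' : Y ⟶ triBase (y : PolyCat E) y} : c = c' :=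
  pos_unit_ext (terminal.hom_ext _ _)

/-- Fixes the direction of `y` to its normal form, so that the left-hand side determines the
right-hand side and the equation can serve as a rewriting rule. -/
theorem comp_triLeftUnitor_hom_pos' (c : Y ⟶ triBase y p) :
    c ≫ Hom.pos (triLeftUnitor p).hom =
      eval (p := y) (q := p) c (terminal.from Y) (terminal.hom_ext _ _) :=
  comp_triLeftBase p c _ _

theorem triLeftUnitor_hom_app (c : Y ⟶ triBase y p) (d : Y ⟶ p.total)
    (h : c ≫ Hom.pos (triLeftUnitor p).hom = d ≫ p.map) :
    Hom.app (triLeftUnitor p).hom c d h = mkDir (p := y) (q := p) c (terminal.from Y)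
      (terminal.hom_ext _ _) d ((comp_triLeftUnitor_hom_pos c _ _).symm.trans h) := by
  refine dir_ext (p := y) ?_ (terminal.hom_ext _ _) ?_
  · exact (Hom.app_map _ _ _ _).trans (mkDir_hom _ _ _ _ _).symm
  · rw [triLeftUnitor_hom_app_snd, mkDir_snd]

theorem triRightUnitor_hom_app (c : Y ⟶ triBase p y) (d : Y ⟶ p.total)
    (h : c ≫ Hom.pos (triRightUnitor p).hom = d ≫ p.map) :
    Hom.app (triRightUnitor p).hom c d h = mkDir (p := p) (q := y) c d
      ((comp_triRightUnitor_hom_pos c).symm.trans h) (terminal.from Y)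
      (terminal.hom_ext _ _) := by
  refine dir_ext (q := y) ?_ ?_ (terminal.hom_ext _ _)
  · exact (Hom.app_map _ _ _ _).trans (mkDir_hom _ _ _ _ _).symm
  · rw [triRightUnitor_hom_app_fst, mkDir_fst]

/-! ### The interchange on generalized elements -/

section

variable (c : Y ⟶ triBase p q ⨯ triBase r s) (e : Y ⟶ triTotal (tensor p r) (tensor q s))

theorem interchange_dir_proj
    (h : c ≫ Hom.pos (interchange p q r s) = e ≫ triHom (tensor p r) (tensor q s)) :
    prod.lift ((c ≫ prod.fst) ≫ triProj p q) ((c ≫ prod.snd) ≫ triProj r s) =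
      (e ≫ dirFst (tensor p r) (tensor q s)) ≫ prod.map p.map r.map := by
  rw [← comp_interchange_pos_proj, h, dir_proj]

theorem interchange_dir_proj_fst
    (h : c ≫ Hom.pos (interchange p q r s) = e ≫ triHom (tensor p r) (tensor q s)) :
    (c ≫ prod.fst) ≫ triProj p q = ((e ≫ dirFst (tensor p r) (tensor q s)) ≫ prod.fst) ≫ p.map := by
  simpa [prod.lift_fst] using interchange_dir_proj c e h =≫ prod.fst

theorem interchange_dir_proj_snd
    (h : c ≫ Hom.pos (interchange p q r s) = e ≫ triHom (tensor p r) (tensor q s)) :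
    (c ≫ prod.snd) ≫ triProj r s = ((e ≫ dirFst (tensor p r) (tensor q s)) ≫ prod.snd) ≫ r.map := by
  simpa [prod.lift_snd] using interchange_dir_proj c e h =≫ prod.snd

theorem interchange_dir_eval
    (h : c ≫ Hom.pos (interchange p q r s) = e ≫ triHom (tensor p r) (tensor q s)) :
    prod.lift
      (eval (c ≫ prod.fst) ((e ≫ dirFst (tensor p r) (tensor q s)) ≫ prod.fst)
        (interchange_dir_proj_fst c e h))
      (eval (c ≫ prod.snd) ((e ≫ dirFst (tensor p r) (tensor q s)) ≫ prod.snd)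
        (interchange_dir_proj_snd c e h)) =
      (e ≫ dirSnd (tensor p r) (tensor q s)) ≫ prod.map q.map s.map :=
  (eval_comp_interchange_pos c _ (by rw [h, dir_proj])).symm.trans
    ((eval_congr (p := tensor p r) (q := tensor q s) h rfl _).trans (dir_eval e))

theorem interchange_dir_eval_fst
    (h : c ≫ Hom.pos (interchange p q r s) = e ≫ triHom (tensor p r) (tensor q s)) :
    eval (c ≫ prod.fst) ((e ≫ dirFst (tensor p r) (tensor q s)) ≫ prod.fst)
      (interchange_dir_proj_fst c e h) =
      ((e ≫ dirSnd (tensor p r) (tensor q s)) ≫ prod.fst) ≫ q.map := by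
  simpa [prod.lift_fst] using interchange_dir_eval c e h =≫ prod.fst

theorem interchange_dir_eval_snd
    (h : c ≫ Hom.pos (interchange p q r s) = e ≫ triHom (tensor p r) (tensor q s)) :
    eval (c ≫ prod.snd) ((e ≫ dirFst (tensor p r) (tensor q s)) ≫ prod.snd)
      (interchange_dir_proj_snd c e h) =
      ((e ≫ dirSnd (tensor p r) (tensor q s)) ≫ prod.snd) ≫ s.map := by
  simpa [prod.lift_snd] using interchange_dir_eval c e h =≫ prod.snd

/-- The two triples are obtained by regrouping the components of `e = ((a, a'), (d, d'))` by tensor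
factor. -/
theorem interchange_app
    (h : c ≫ Hom.pos (interchange p q r s) = e ≫ triHom (tensor p r) (tensor q s)) :
    Hom.app (interchange p q r s) c e h = prod.lift
      (mkDir (c ≫ prod.fst) ((e ≫ dirFst (tensor p r) (tensor q s)) ≫ prod.fst)
        (interchange_dir_proj_fst c e h) ((e ≫ dirSnd (tensor p r) (tensor q s)) ≫ prod.fst)
        (interchange_dir_eval_fst c e h))
      (mkDir (c ≫ prod.snd) ((e ≫ dirFst (tensor p r) (tensor q s)) ≫ prod.snd)
        (interchange_dir_proj_snd c e h) ((e ≫ dirSnd (tensor p r) (tensor q s)) ≫ prod.snd)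
        (interchange_dir_eval_snd c e h)) := by
  have h₀ : pullback.lift c e h ≫ pullback.fst _ _ = c := pullback.lift_fst _ _ _
  have h₁ : pullback.lift c e h ≫ pullback.snd _ _ = e := pullback.lift_snd _ _ _
  refine (comp_prodLift _ _ _).trans (congrArg₂ prod.lift ?_ ?_) <;>
  · refine (comp_mkDir _ _ _ _ _ _).trans (mkDir_congr ?_ ?_ ?_ _ _)
    · exact (Category.assoc _ _ _).symm.trans (congrArg (· ≫ _) h₀)
    · exact (Category.assoc _ _ _).symm.trans (congrArg (· ≫ _)
        ((Category.assoc _ _ _).symm.trans (congrArg (· ≫ _) h₁)))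
    · exact (Category.assoc _ _ _).symm.trans (congrArg (· ≫ _)
        ((Category.assoc _ _ _).symm.trans (congrArg (· ≫ _) h₁)))

end

/-! ### The tensor product is monoidal -/

theorem tensorMap_id : tensorMap (𝟙 p) (𝟙 q) = 𝟙 (tensor p q) := by
  refine Hom.ext_app (by simp [tensorMap_pos]) fun Y b d h h' => ?_
  rw [tensorMap_app, id_app, id_app, id_app, prodLift_eta]

theorem tensorMap_comp {p p' p'' q q' q'' : PolyCat E} (φ : p ⟶ p') (ψ : q ⟶ q') (φ' : p' ⟶ p'')
    (ψ' : q' ⟶ q'') :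
    tensorMap φ ψ ≫ tensorMap φ' ψ' = tensorMap (φ ≫ φ') (ψ ≫ ψ') := by
  refine Hom.ext_app (by simp [tensorMap_pos]) fun Y b d h h' => ?_
  simp only [tensorMap_app, comp_app, tensorMap_pos, comp_prodMap, prod.lift_fst, prod.lift_snd]

theorem tensorAssoc_naturality (φ : p ⟶ p') (ψ : q ⟶ q') (χ : r ⟶ r') :
    tensorMap (tensorMap φ ψ) χ ≫ (tensorAssoc p' q' r').hom =
      (tensorAssoc p q r).hom ≫ tensorMap φ (tensorMap ψ χ) := by
  refine Hom.ext_app (by simp [tensorMap_pos, tensorAssoc_hom_pos]) fun Y b d h h' => ?_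
  simp only [tensorMap_app, comp_app, tensorMap_pos, comp_prodMap, prod.lift_fst, prod.lift_snd,
    tensorAssoc_hom_pos, tensorAssoc_hom_app, comp_prodAssociator_hom]

theorem tensorLeftUnitor_naturality (φ : p ⟶ p') :
    tensorMap (𝟙 y) φ ≫ (tensorLeftUnitor p').hom = (tensorLeftUnitor p).hom ≫ φ := by
  refine Hom.ext_app (by simp [tensorMap_pos, tensorLeftUnitor_hom_pos]) fun Y b d h h' => ?_
  simp only [tensorMap_app, comp_app, tensorMap_pos, comp_prodMap, prod.lift_fst, prod.lift_snd,
    tensorLeftUnitor_hom_pos, tensorLeftUnitor_hom_app, id_app]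

theorem tensorRightUnitor_naturality (φ : p ⟶ p') :
    tensorMap φ (𝟙 y) ≫ (tensorRightUnitor p').hom = (tensorRightUnitor p).hom ≫ φ := by
  refine Hom.ext_app (by simp [tensorMap_pos, tensorRightUnitor_hom_pos]) fun Y b d h h' => ?_
  simp only [tensorMap_app, comp_app, tensorMap_pos, comp_prodMap, prod.lift_fst, prod.lift_snd,
    tensorRightUnitor_hom_pos, tensorRightUnitor_hom_app, id_app]

theorem tensor_pentagon :
    tensorMap (tensorAssoc p q r).hom (𝟙 s) ≫ (tensorAssoc p (tensor q r) s).hom ≫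
        tensorMap (𝟙 p) (tensorAssoc q r s).hom =
      (tensorAssoc (tensor p q) r s).hom ≫ (tensorAssoc p q (tensor r s)).hom := by
  refine Hom.ext_elements (fun Y b => ?_) fun Y b d h h' => ?_
  all_goals
    simp only [tensorMap_app, comp_app, comp_comp_pos, tensorMap_pos, id_pos, comp_prodMap,
      prod.lift_fst, prod.lift_snd, tensorAssoc_hom_pos, tensorAssoc_hom_app,
      comp_prodAssociator_hom, id_app, Category.comp_id, ← Category.assoc]

theorem tensor_triangle :
    (tensorAssoc p y q).hom ≫ tensorMap (𝟙 p) (tensorLeftUnitor q).hom =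
      tensorMap (tensorRightUnitor p).hom (𝟙 q) := by
  refine Hom.ext_elements (fun Y b => ?_) fun Y b d h h' => ?_
  all_goals
    simp only [tensorMap_app, comp_app, comp_comp_pos, tensorMap_pos, id_pos, comp_prodMap,
      prod.lift_fst, prod.lift_snd, tensorAssoc_hom_pos, tensorAssoc_hom_app,
      comp_prodAssociator_hom, id_app, Category.comp_id, tensorLeftUnitor_hom_pos,
      tensorRightUnitor_hom_pos, tensorLeftUnitor_hom_app, tensorRightUnitor_hom_app]

theorem isMonoidal_tensorStruct : IsMonoidal (tensorStruct E) := by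
  refine ⟨{ toMonoidalCategoryStruct := tensorStruct E
            tensorHom_def := ?_
            id_tensorHom_id := fun p q => tensorMap_id
            tensorHom_comp_tensorHom := fun _ _ _ _ => tensorMap_comp _ _ _ _
            whiskerLeft_id := fun _ _ => tensorMap_id
            id_whiskerRight := fun _ _ => tensorMap_id
            associator_naturality := fun _ _ _ => tensorAssoc_naturality _ _ _
            leftUnitor_naturality := fun _ => tensorLeftUnitor_naturality _
            rightUnitor_naturality := fun _ => tensorRightUnitor_naturality _
            pentagon := fun _ _ _ _ => tensor_pentagon
            triangle := fun _ _ => tensor_triangle }, rfl⟩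
  intro p p' q q' φ ψ
  -- Whiskering is tensoring with an identity, so `tensorHom_def` is functoriality applied to `φ = φ
  -- ≫ 𝟙` and `ψ = 𝟙 ≫ ψ`.
  exact (congrArg₂ tensorMap (Category.comp_id φ) (Category.id_comp ψ)).symm.trans
    (tensorMap_comp φ (𝟙 _) (𝟙 _) ψ).symm


/-! ### The composition product is monoidal -/

theorem triMap_id : triMap (𝟙 p) (𝟙 q) = 𝟙 (tri p q) := by
  refine Hom.ext_elements (fun Y c => ?_) fun Y c e h h' => ?_
  · refine pos_ext ?_ fun Z x a hc hc' => ?_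
    all_goals
      simp only [← Category.assoc, Category.comp_id, id_pos, id_app, comp_triMap_pos_proj,
        eval_comp_triMap_pos]
  -- The identity returns the direction `e` itself while `triMap` returns a triple, so the
  -- comparison is made on projections.
  · apply dir_ext
    · rw [Hom.app_map, Hom.app_map]
    all_goals
      simp only [id_app, triMap_app_eq, mkDir_fst, mkDir_snd]

theorem triMap_comp {p p' p'' q q' q'' : PolyCat E} (φ : p ⟶ p') (ψ : q ⟶ q') (φ' : p' ⟶ p'')
    (ψ' : q' ⟶ q'') :
    triMap φ ψ ≫ triMap φ' ψ' = triMap (φ ≫ φ') (ψ ≫ ψ') := by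
  refine Hom.ext_elements (fun Y c => ?_) fun Y c e h h' => ?_
  · refine pos_ext ?_ fun Z x a hc hc' => ?_
    all_goals
      simp only [← Category.assoc, comp_comp_pos, comp_app, comp_triMap_pos_proj,
        eval_comp_triMap_pos]
  · simp only [comp_app, comp_triMap_pos_proj, eval_comp_triMap_pos, triMap_app_eq, mkDir_fst,
      mkDir_snd]

theorem triAssoc_naturality (φ : p ⟶ p') (ψ : q ⟶ q') (χ : r ⟶ r') :
    triMap (triMap φ ψ) χ ≫ (triAssoc p' q' r').hom =
      (triAssoc p q r).hom ≫ triMap φ (triMap ψ χ) := by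
  refine Hom.ext_elements (fun Y c => ?_) fun Y c e h h' => ?_
  -- The value of a position of `p' ◁ (q' ◁ r')` is itself a position of `q' ◁ r'`, hence
  -- extensionality is used twice, each time at a new stage.
  · refine pos_ext (q := tri q' r') ?_ fun Z x a hc hc' => pos_ext ?_ fun W z d hd hd' => ?_
    all_goals
      simp only [← Category.assoc, comp_comp_pos, Hom.comp_app, comp_eval, comp_triMap_pos_proj,
        eval_comp_triMap_pos, triMap_app_eq, mkDir_fst, mkDir_snd, comp_triAssoc_hom_pos_proj,
        eval_comp_triAssoc_hom_pos_proj, eval_eval_comp_triAssoc_hom_pos]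
  · simp only [comp_app, comp_triMap_pos_proj, triMap_app_eq, mkDir_fst, mkDir_snd,
      comp_triAssoc_hom_pos_proj, eval_comp_triAssoc_hom_pos_proj, eval_eval_comp_triAssoc_hom_pos,
      triAssoc_hom_app]

theorem triLeftUnitor_naturality (φ : p ⟶ p') :
    triMap (𝟙 y) φ ≫ (triLeftUnitor p').hom = (triLeftUnitor p).hom ≫ φ := by
  refine Hom.ext_elements (fun Y c => ?_) fun Y c e h h' => ?_
  all_goals
    simp only [comp_comp_pos, comp_app, eval_comp_triMap_pos, triMap_app_eq, mkDir_snd,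
      comp_triLeftUnitor_hom_pos', triLeftUnitor_hom_app, app_unit, comp_dirFst_unit,
      comp_triProj_unit]

theorem triRightUnitor_naturality (φ : p ⟶ p') :
    triMap φ (𝟙 y) ≫ (triRightUnitor p').hom = (triRightUnitor p).hom ≫ φ := by
  refine Hom.ext_elements (fun Y c => ?_) fun Y c e h h' => ?_
  all_goals
    simp only [comp_comp_pos, comp_app, comp_triMap_pos_proj, triMap_app_eq, mkDir_fst,
      comp_triRightUnitor_hom_pos, triRightUnitor_hom_app, app_unit, comp_dirSnd_unit, eval_unit]

theorem tri_pentagon :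
    triMap (triAssoc p q r).hom (𝟙 s) ≫ (triAssoc p (tri q r) s).hom ≫
        triMap (𝟙 p) (triAssoc q r s).hom =
      (triAssoc (tri p q) r s).hom ≫ (triAssoc p q (tri r s)).hom := by
  refine Hom.ext_elements (fun Y c => ?_) fun Y c e h h' => ?_
  -- Three nested evaluations, at directions of `p`, `q` and `r`, determine a position of `p ◁ (q ◁
  -- (r ◁ s))`. The change of stage made at each level is pushed inwards by `comp_eval` and
  -- `comp_mkDir`.
  · refine pos_ext (q := tri q (tri r s)) ?_ fun Z x a hc hc' =>
      pos_ext (q := tri r s) ?_ fun W z d hd hd' => pos_ext ?_ fun V w f hf hf' => ?_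
    all_goals
      simp only [← Category.assoc, Category.comp_id, id_pos, id_app, comp_comp_pos, comp_eval,
        comp_triMap_pos_proj, eval_comp_triMap_pos, comp_mkDir, mkDir_fst, mkDir_snd,
        comp_triAssoc_hom_pos_proj, eval_comp_triAssoc_hom_pos_proj,
        eval_eval_comp_triAssoc_hom_pos, triAssoc_hom_app]
  · simp only [← Category.assoc, id_app, comp_comp_pos, comp_app, comp_triMap_pos_proj,
      triMap_app_eq, mkDir_fst, mkDir_snd, comp_triAssoc_hom_pos_proj,
      eval_comp_triAssoc_hom_pos_proj, triAssoc_hom_app]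

theorem tri_triangle :
    (triAssoc p y q).hom ≫ triMap (𝟙 p) (triLeftUnitor q).hom =
      triMap (triRightUnitor p).hom (𝟙 q) := by
  refine Hom.ext_elements (fun Y c => ?_) fun Y c e h h' => ?_
  · refine pos_ext ?_ fun Z x a hc hc' => ?_
    all_goals
      simp only [← Category.assoc, Category.comp_id, id_pos, id_app, comp_comp_pos,
        comp_triMap_pos_proj, eval_comp_triMap_pos, comp_triAssoc_hom_pos_proj,
        eval_eval_comp_triAssoc_hom_pos, comp_triLeftUnitor_hom_pos', comp_triRightUnitor_hom_pos,
        triRightUnitor_hom_app]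
  · simp only [id_app, comp_app, triMap_app_eq, mkDir_fst, mkDir_snd, comp_triAssoc_hom_pos_proj,
      triAssoc_hom_app, triLeftUnitor_hom_app, triRightUnitor_hom_app, comp_dirFst_unit]

theorem isMonoidal_triStruct : IsMonoidal (triStruct E) := by
  refine ⟨{ toMonoidalCategoryStruct := triStruct E
            tensorHom_def := ?_
            id_tensorHom_id := fun p q => triMap_id
            tensorHom_comp_tensorHom := fun _ _ _ _ => triMap_comp _ _ _ _
            whiskerLeft_id := fun _ _ => triMap_id
            id_whiskerRight := fun _ _ => triMap_id
            associator_naturality := fun _ _ _ => triAssoc_naturality _ _ _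
            leftUnitor_naturality := fun _ => triLeftUnitor_naturality _
            rightUnitor_naturality := fun _ => triRightUnitor_naturality _
            pentagon := fun _ _ _ _ => tri_pentagon
            triangle := fun _ _ => tri_triangle }, rfl⟩
  intro p p' q q' φ ψ
  exact (congrArg₂ triMap (Category.comp_id φ) (Category.id_comp ψ)).symm.trans
    (triMap_comp φ (𝟙 _) (𝟙 _) ψ).symm

end

section

variable {E : Type u} [Category.{v} E] [HasFiniteLimits E]

variable {p p' q q' r r' s s' t w : PolyCat E} {Y : E}

/-! ### The duoidal axioms -/

theorem interchange_naturality (φ : p ⟶ p') (ψ : q ⟶ q') (χ : r ⟶ r') (ω : s ⟶ s') :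
    tensorMap (triMap φ ψ) (triMap χ ω) ≫ interchange p' q' r' s' =
      interchange p q r s ≫ triMap (tensorMap φ χ) (tensorMap ψ ω) := by
  refine Hom.ext_elements (fun Y c => ?_) fun Y c e h h' => ?_
  · refine pos_ext (p := tensor p' r') (q := tensor q' s') ?_ fun Z x a hc hc' => ?_
    all_goals
      simp only [← Category.assoc, comp_comp_pos, tensorMap_pos, tensorMap_app, comp_prodMap,
        comp_prodLift, prod.lift_fst, prod.lift_snd, comp_triMap_pos_proj, eval_comp_triMap_pos,
        comp_interchange_pos_proj, eval_comp_interchange_pos]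
  · simp only [comp_app, tensorMap_pos, tensorMap_app, comp_prodMap, prod.lift_fst, prod.lift_snd,
      triMap_app_eq, mkDir_fst, mkDir_snd, comp_interchange_pos_proj, eval_comp_interchange_pos,
      interchange_app]

theorem interchange_tensorAssoc :
    tensorMap (interchange p q r s) (𝟙 (tri t w)) ≫
        interchange (tensor p r) (tensor q s) t w ≫
        triMap (tensorAssoc p r t).hom (tensorAssoc q s w).hom =
      (tensorAssoc (tri p q) (tri r s) (tri t w)).hom ≫
        tensorMap (𝟙 (tri p q)) (interchange r s t w) ≫
        interchange p q (tensor r t) (tensor s w) := by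
  refine Hom.ext_elements (fun Y c => ?_) fun Y c e h h' => ?_
  · refine pos_ext (p := tensor p (tensor r t)) (q := tensor q (tensor s w)) ?_
      fun Z x a hc hc' => ?_
    all_goals
      simp only [← Category.assoc, Category.comp_id, id_pos, comp_comp_pos, tensorMap_pos,
        comp_prodMap, comp_prodLift, prod.lift_fst, prod.lift_snd, tensorAssoc_hom_pos,
        comp_prodAssociator_hom, tensorAssoc_hom_app, comp_triMap_pos_proj, eval_comp_triMap_pos,
        comp_interchange_pos_proj, eval_comp_interchange_pos]
  · simp only [← Category.assoc, Category.comp_id, id_pos, id_app, comp_comp_pos, comp_app,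
      tensorMap_pos, tensorMap_app, comp_prodMap, prod.lift_fst, prod.lift_snd, tensorAssoc_hom_pos,
      comp_prodAssociator_hom, tensorAssoc_hom_app, triMap_app_eq, mkDir_fst, mkDir_snd,
      comp_interchange_pos_proj, eval_comp_interchange_pos, interchange_app]

/-- Currying is compatible with pairing of functions. On the left, a direction `((a, a'), (d, d'))`
of `(p ⊗ s) ◁ (q ⊗ t)` passes through the interchange and becomes the pair `(a, d)`, `(a', d')`; on
the right, each factor is curried separately and then evaluated at `a`, `d` and at `a'`, `d'`. -/
theorem interchange_triAssoc :
    interchange (tri p q) r (tri s t) w ≫ triMap (interchange p q s t) (𝟙 (tensor r w)) ≫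
        (triAssoc (tensor p s) (tensor q t) (tensor r w)).hom =
      tensorMap (triAssoc p q r).hom (triAssoc s t w).hom ≫
        interchange p (tri q r) s (tri t w) ≫
        triMap (𝟙 (tensor p s)) (interchange q r t w) := by
  refine Hom.ext_elements (fun Y c => ?_) fun Y c e h h' => ?_
  · refine pos_ext (p := tensor p s) (q := tri (tensor q t) (tensor r w)) ?_
      fun Z x a hc hc' => pos_ext (p := tensor q t) (q := tensor r w) ?_ fun W z d hd hd' => ?_
    all_goals
      simp only [← Category.assoc, Category.comp_id, id_pos, id_app, comp_comp_pos, comp_eval,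
        tensorMap_pos, comp_prodMap, comp_prodLift, prod.lift_fst, prod.lift_snd,
        comp_triMap_pos_proj, eval_comp_triMap_pos, mkDir_fst, mkDir_snd,
        comp_triAssoc_hom_pos_proj, eval_comp_triAssoc_hom_pos_proj,
        eval_eval_comp_triAssoc_hom_pos, comp_interchange_pos_proj, eval_comp_interchange_pos,
        interchange_app]
  · simp only [← Category.assoc, id_app, comp_comp_pos, comp_app, tensorMap_pos, tensorMap_app,
      comp_prodMap, prod.lift_fst, prod.lift_snd, comp_triMap_pos_proj, triMap_app_eq, mkDir_fst,
      mkDir_snd, comp_triAssoc_hom_pos_proj, triAssoc_hom_app, comp_interchange_pos_proj,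
      eval_comp_interchange_pos, interchange_app]

theorem interchange_tensorLeftUnitor :
    tensorMap (triLeftUnitor y).inv (𝟙 (tri p q)) ≫ interchange y y p q ≫
        triMap (tensorLeftUnitor p).hom (tensorLeftUnitor q).hom =
      (tensorLeftUnitor (tri p q)).hom := by
  refine Hom.ext_elements (fun Y c => ?_) fun Y c e h h' => ?_
  · refine pos_ext ?_ fun Z x a hc hc' => ?_
    all_goals
      simp only [← Category.assoc, Category.comp_id, id_pos, comp_comp_pos, tensorMap_pos,
        comp_prodMap, comp_prodLift, prod.lift_fst, prod.lift_snd, tensorLeftUnitor_hom_pos,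
        tensorLeftUnitor_hom_app, comp_triMap_pos_proj, eval_comp_triMap_pos,
        comp_interchange_pos_proj, eval_comp_interchange_pos, comp_triProj_unit, eval_unit]
  · simp only [← Category.assoc, Category.comp_id, id_pos, id_app, comp_comp_pos, comp_app,
      tensorMap_pos, tensorMap_app, comp_prodMap, prod.lift_fst, prod.lift_snd,
      tensorLeftUnitor_hom_app, triMap_app_eq, mkDir_fst, mkDir_snd, comp_interchange_pos_proj,
      eval_comp_interchange_pos, interchange_app, app_unit, comp_triProj_unit, eval_unit]
    -- The left side has taken the direction of `p ◁ q` apart and rebuilt it, whereas the unitor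
    -- returns it whole; `h'` says that it lies over the second component of the position.
    exact congrArg (prod.lift _) (mkDir_eta_of_eq _ _ h')

theorem interchange_tensorRightUnitor :
    tensorMap (𝟙 (tri p q)) (triLeftUnitor y).inv ≫ interchange p q y y ≫
        triMap (tensorRightUnitor p).hom (tensorRightUnitor q).hom =
      (tensorRightUnitor (tri p q)).hom := by
  refine Hom.ext_elements (fun Y c => ?_) fun Y c e h h' => ?_
  · refine pos_ext ?_ fun Z x a hc hc' => ?_
    all_goals
      simp only [← Category.assoc, Category.comp_id, id_pos, comp_comp_pos, tensorMap_pos,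
        comp_prodMap, comp_prodLift, prod.lift_fst, prod.lift_snd, tensorRightUnitor_hom_pos,
        tensorRightUnitor_hom_app, comp_triMap_pos_proj, eval_comp_triMap_pos,
        comp_interchange_pos_proj, eval_comp_interchange_pos, comp_triProj_unit, eval_unit]
  · simp only [← Category.assoc, Category.comp_id, id_pos, id_app, comp_comp_pos, comp_app,
      tensorMap_pos, tensorMap_app, comp_prodMap, prod.lift_fst, prod.lift_snd,
      tensorRightUnitor_hom_app, triMap_app_eq, mkDir_fst, mkDir_snd, comp_interchange_pos_proj,
      eval_comp_interchange_pos, interchange_app, app_unit, comp_triProj_unit, eval_unit]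
    exact congrArg (prod.lift · _) (mkDir_eta_of_eq _ _ h')

/-- The target is `p ⊗ q`, whose positions form a plain product, so extensionality for `Π` plays no
role: the left unitor evaluates at the only direction of `y`, and the interchange evaluates each
factor there. -/
theorem interchange_triLeftUnitor :
    interchange y p y q ≫ triMap (tensorLeftUnitor y).hom (𝟙 (tensor p q)) ≫
        (triLeftUnitor (tensor p q)).hom =
      tensorMap (triLeftUnitor p).hom (triLeftUnitor q).hom := by
  refine Hom.ext_elements (fun Y c => ?_) fun Y c e h h' => ?_
  all_goals
    simp only [← Category.assoc, Category.comp_id, id_pos, id_app, comp_comp_pos, comp_app,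
      tensorMap_pos, tensorMap_app, comp_prodMap, prod.lift_fst, prod.lift_snd,
      tensorLeftUnitor_hom_app, eval_comp_triMap_pos, triMap_app_eq, mkDir_fst, mkDir_snd,
      comp_triLeftUnitor_hom_pos', triLeftUnitor_hom_app, comp_interchange_pos_proj,
      eval_comp_interchange_pos, interchange_app, comp_dirFst_unit, comp_triProj_unit]

theorem interchange_triRightUnitor :
    interchange p y q y ≫ triMap (𝟙 (tensor p q)) (tensorLeftUnitor y).hom ≫
        (triRightUnitor (tensor p q)).hom =
      tensorMap (triRightUnitor p).hom (triRightUnitor q).hom := by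
  refine Hom.ext_elements (fun Y c => ?_) fun Y c e h h' => ?_
  all_goals
    simp only [← Category.assoc, Category.comp_id, id_pos, id_app, comp_comp_pos, comp_app,
      tensorMap_pos, tensorMap_app, comp_prodMap, prod.lift_fst, prod.lift_snd,
      tensorLeftUnitor_hom_app, comp_triMap_pos_proj, triMap_app_eq, mkDir_fst, mkDir_snd,
      comp_triRightUnitor_hom_pos, triRightUnitor_hom_app, comp_interchange_pos_proj,
      eval_comp_interchange_pos, interchange_app, comp_dirSnd_unit, eval_unit]

/-! ### Axioms involving only the units -/

theorem tensorLeftUnitor_unit :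
    (tensorLeftUnitor (y : PolyCat E)).hom = (tensorRightUnitor y).hom :=
  Hom.ext_elements (fun _ _ => terminal.hom_ext _ _) fun _ _ _ _ _ =>
    Limits.prod.hom_ext (terminal.hom_ext _ _) (terminal.hom_ext _ _)

theorem tensorLeftUnitor_unit_assoc :
    tensorMap (tensorLeftUnitor (y : PolyCat E)).hom (𝟙 y) ≫ (tensorLeftUnitor y).hom =
      (tensorAssoc y y y).hom ≫ tensorMap (𝟙 y) (tensorLeftUnitor y).hom ≫
        (tensorLeftUnitor y).hom :=
  Hom.ext_elements (fun _ _ => terminal.hom_ext _ _) fun _ _ _ _ _ =>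
    Limits.prod.hom_ext (Limits.prod.hom_ext (terminal.hom_ext _ _) (terminal.hom_ext _ _))
      (terminal.hom_ext _ _)

theorem hom_unit_ext {φ ψ : (y : PolyCat E) ⟶ y} : φ = ψ :=
  Hom.ext_elements (fun _ _ => terminal.hom_ext _ _) fun _ _ _ _ _ => terminal.hom_ext _ _

/-- The positions of `y ◁ (y ◁ y)` form a terminal object, by `Π_1 (P × 1) ≅ P` used twice, and the
direction part of a morphism out of `y` has terminal codomain. Coassociativity of the
comultiplication is an instance. -/
theorem hom_unit_tri_ext {φ ψ : (y : PolyCat E) ⟶ tri y (tri y y)} : φ = ψ :=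
  Hom.ext_elements (fun _ _ => pos_unit_ext (p := tri y y) triBase_unit_ext)
    fun _ _ _ _ _ => terminal.hom_ext _ _

/-- The duoidal category `(Poly_E, y, ⊗, y, ◁)`. -/
theorem isDuoidal_duoidalStruct : (duoidalStruct E).IsDuoidal where
  monoidal_M := isMonoidal_tensorStruct
  monoidal_N := isMonoidal_triStruct
  interchange_natural := interchange_naturality
  interchange_assoc_M _ _ _ _ _ _ := interchange_tensorAssoc
  interchange_assoc_N _ _ _ _ _ _ := interchange_triAssoc
  left_unit_M _ _ := interchange_tensorLeftUnitor
  right_unit_M _ _ := interchange_tensorRightUnitor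
  left_unit_N _ _ := interchange_triLeftUnitor
  right_unit_N _ _ := interchange_triRightUnitor
  -- The comparison of units is `𝟙 y` and the multiplication is the left unitor of `⊗` at `y`, so
  -- whiskering the former gives an identity and the left law is immediate; the right law also uses
  -- that the two unitors agree at `y`.
  unit_mult := (congrArg (· ≫ _) tensorMap_id).trans (Category.id_comp _)
  mult_unit := (congrArg (· ≫ _) tensorMap_id).trans
    ((Category.id_comp _).trans tensorLeftUnitor_unit)
  mult_assoc := tensorLeftUnitor_unit_assoc
  unit_comult := hom_unit_ext
  comult_unit := hom_unit_ext
  comult_assoc := hom_unit_tri_ext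

end

end PolyCat

theorem mainTheorem5 {E : Type u} [Category.{v} E] [HasFiniteLimits E] :
    IsMonoidal (PolyCat.tensorStruct E) ∧ (PolyCat.duoidalStruct E).IsNormalDuoidal :=
  ⟨PolyCat.isMonoidal_tensorStruct, PolyCat.isDuoidal_duoidalStruct,
    inferInstanceAs (IsIso (𝟙 (PolyCat.y : PolyCat E)))⟩
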